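/- Let $T$ be a $(d_1,d_2)$-biregular tree with $d_1,d_2\ge 3$, with vertex set $VT$ and graph distance $d$. Let $\operatorname{Aut}(T)$ be the group of automorphisms $g$ of $T$ acting without edge inversion, i.e. such that $d(gv,v)$ is even for one (equivalently, every) vertex $v$, with the topology of pointwise convergence; write $G_{v}$ for the stabilizer of $v\in VT$ in $\operatorname{Aut}(T)$. Let $\Gamma\le\operatorname{Aut}(T)$ be a tree lattice, i.e. a discrete subgroup such that $X=\operatorname{Aut}(T)/\Gamma$ carries an $\operatorname{Aut}(T)$-invariant Borel probability measure. Let $Q=\Gamma\backslash T$ be the quotient graph, $\pi:T\to Q$ the projection, and index each oriented edge $\pi(e)$ of $Q$, where $e$ is an oriented edge of $T$ with initial vertex $v$, by $[\Gamma_{v}:\Gamma_{e}]$. Assume that $\Gamma$ is geometrically finite: $Q$ contains a finite subgraph whose complement is a disjoint union of finitely many open Nagao rays. Here a Nagao ray is an infinite ray in which every oriented edge directed towards infinity has index $1$, except the one emanating from the origin (whose index is arbitrary), and every oriented edge directed away from infinity has index one less than the valency (in $T$, of any lift) of its initial vertex; an open Nagao ray is a Nagao ray with its origin removed. Let $m$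 be a Haar measure on $\operatorname{Aut}(T)$ and $m_X$ the measure it induces on $X$, i.e. the image of the restriction of $m$ to a Borel fundamental domain for the right multiplication action of $\Gamma$. Then $0<m_X(X)<\infty$. Fix a vertex $\tilde o\in VT$ and for $R\in\mathbb N$ let $$N(R)=\#\{\gamma\in\Gamma : d(\gamma\tilde o,\tilde o)\le R\},\qquad B_T(R)=\#\{v\in VT : d(v,\tilde o)\text{ is even and at most } R\}.$$ Then there exists $c\in(0,1)$ such that $$\left|\frac{N(2R)}{B_T(2R)}-\frac{m(G_{\tilde o})}{m_X(X)}\right|=o(c^{2R})\qquad\text{as } R\to\infty .$$ Moreover $$\frac{m(G_{\tilde o})}{m_X(X)}=\Bigl(\sum_{v\in V'Q}\frac1{|\Gamma\cap G_{\tilde v}|}\Bigr)^{-1},$$ where $V'Q$ is the set of vertices of $Q$ at even distance from $\pi(\tilde o)$ in $Q$, $\tilde v\in VT$ is any lift of $v$, and the sum converges. -/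

import Mathlib

open MeasureTheory Filter Asymptotics Topology
open scoped ENNReal

/-! ### Trees and their automorphism groups -/

/-- `T` is a `(d₁, d₂)`-biregular tree: a tree whose vertices are coloured with two colours so that
neighbours have different colours, the vertices of the first colour have valency `d₁` and those
of the second colour have valency `d₂`. -/
def IsBiregularTree {V : Type*} (T : SimpleGraph V) (d₁ d₂ : ℕ) : Prop :=
  T.IsTree ∧ ∃ c : T.Coloring Bool, ∀ v, (T.neighborSet v).encard = bif c v then d₁ else d₂

/-- The group of automorphisms of a graph that move every vertex along walks of even
length. For a tree this is the group of automorphisms acting without edge inversion, in the sense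
that `d(gv, v)` is even for one, equivalently every, vertex `v`: see `mem_evenAut_iff`. -/
def evenAut {V : Type*} (T : SimpleGraph V) : Subgroup (T ≃g T) where
  carrier := {g | ∀ v, ∃ p : T.Walk (g v) v, Even p.length}
  one_mem' v := ⟨SimpleGraph.Walk.nil, by simp⟩
  mul_mem' {g h} hg hh v := by
    obtain ⟨p, hp⟩ := hg (h v)
    obtain ⟨q, hq⟩ := hh v
    exact ⟨p.append q, (SimpleGraph.Walk.length_append p q).symm ▸ hp.add hq⟩
  inv_mem' {g} hg v := by
    obtain ⟨p, hp⟩ := hg (g⁻¹ v)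
    refine ⟨(p.copy (RelIso.apply_inv_self g v) rfl).reverse, ?_⟩
    rwa [SimpleGraph.Walk.length_reverse, SimpleGraph.Walk.length_copy]

theorem even_walk_iff_even_dist {V : Type*} {T : SimpleGraph V} (hT : T.IsTree) {v w : V}
    (p : T.Walk v w) : Even p.length ↔ Even (T.dist v w) := by
  obtain ⟨q, hq⟩ := hT.connected.exists_walk_length_eq_dist v w
  have c : T.Coloring Bool := hT.isBipartite.toColoring (by simp)
  rw [← hq, c.even_length_iff_congr p, c.even_length_iff_congr q]

theorem mem_evenAut_iff {V : Type*} {T : SimpleGraph V} (hT : T.IsTree) (g : T ≃g T) :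
    g ∈ evenAut T ↔ ∀ v, Even (T.dist (g v) v) := by
  constructor
  · intro h v
    obtain ⟨p, hp⟩ := h v
    exact (even_walk_iff_even_dist hT p).1 hp
  · intro h v
    obtain ⟨q, hq⟩ := hT.connected.exists_walk_length_eq_dist (g v) v
    exact ⟨q, by rw [hq]; exact h v⟩

/-- `Aut(T)`, the group of automorphisms of the tree `T` acting without edge inversion. -/
abbrev TreeAut {V : Type*} (T : SimpleGraph V) : Type _ := ↥(evenAut T)

/-- The topology of pointwise convergence on the automorphisms of a graph, the vertex set being
discrete. The subgroup `TreeAut T` carries the subspace topology. -/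
instance autTopologicalSpace {V : Type*} (T : SimpleGraph V) : TopologicalSpace (T ≃g T) :=
  TopologicalSpace.induced (fun g => (g : V → V)) (@Pi.topologicalSpace V (fun _ => V) fun _ => ⊥)

/-- The Borel σ-algebra of the group of automorphisms of a graph. -/
instance autMeasurableSpace {V : Type*} (T : SimpleGraph V) : MeasurableSpace (T ≃g T) :=
  borel (T ≃g T)

instance autBorelSpace {V : Type*} (T : SimpleGraph V) : BorelSpace (T ≃g T) := ⟨rfl⟩

/-- Automorphisms act on oriented edges. -/
instance dartMulAction {V : Type*} (T : SimpleGraph V) : MulAction (T ≃g T) T.Dart where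
  smul g e := ⟨(g e.fst, g e.snd), g.map_adj_iff.2 e.adj⟩
  one_smul _ := rfl
  mul_smul _ _ _ := rfl

/-! ### Tree lattices and induced measures -/

/-- `Γ` is a tree lattice: a discrete subgroup of `Aut(T)` such that `Aut(T)/Γ` carries an
`Aut(T)`-invariant probability measure. The σ-algebra on `Aut(T)/Γ` is the one of the sets whose
preimage in `Aut(T)` is Borel; for discrete `Γ` these are the Borel sets of `Aut(T)/Γ`. -/
def IsTreeLattice {V : Type*} {T : SimpleGraph V} (Γ : Subgroup (TreeAut T)) : Prop :=
  DiscreteTopology Γ ∧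
    ∃ μ : Measure (TreeAut T ⧸ Γ), IsProbabilityMeasure μ ∧
      SMulInvariantMeasure (TreeAut T) (TreeAut T ⧸ Γ) μ

/-- `mX` is the measure induced on `G/Γ` by the measure `m` on `G`: the image of the restriction of
`m` to a Borel fundamental domain for the action of `Γ` on `G` by right multiplication. -/
def IsInducedMeasure {G : Type*} [Group G] [MeasurableSpace G] (Γ : Subgroup G)
    (m : Measure G) (mX : Measure (G ⧸ Γ)) : Prop :=
  ∃ D : Set G, MeasurableSet D ∧ IsFundamentalDomain Γ.op D m ∧
    mX = (m.restrict D).map (QuotientGroup.mk : G → G ⧸ Γ)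

/-! ### Edge-indexed graphs -/

/-- A graph with oriented edges (multiple edges allowed) together with an index for every oriented
edge. -/
structure EdgeIndexedGraph (VQ EQ : Type*) where
  /-- initial vertex of an edge -/
  src : EQ → VQ
  /-- terminal vertex of an edge -/
  tgt : EQ → VQ
  /-- opposite edge -/
  rev : EQ → EQ
  /-- index of an edge -/
  ind : EQ → ℕ
  rev_rev : ∀ e, rev (rev e) = e
  src_rev : ∀ e, src (rev e) = tgt e

namespace EdgeIndexedGraph

variable {VQ EQ : Type*} (Q : EdgeIndexedGraph VQ EQ)

/-- The valency `∑ ind e`, over the edges `e` with initial vertex `v`. -/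
noncomputable def deg (v : VQ) : ℕ := ∑ᶠ e ∈ {e : EQ | Q.src e = v}, Q.ind e

/-- The distance between two vertices: the minimal length of a path between them. (Multiple
edges and loops do not affect it.) -/
noncomputable def dist (u v : VQ) : ℕ :=
  (SimpleGraph.fromRel fun x y => ∃ e, Q.src e = x ∧ Q.tgt e = y).dist u v

/-- The vertices `x 0, x 1, …` and edges `e k` from `x k` to `x (k + 1)` are the vertices and the
edges directed towards infinity of a ray in `Q` that is indexed as a Nagao ray with origin `x 0`:
the edges directed towards infinity have index `1`, except the one that emanates from the origin,
and an edge directed away from infinity has index one less than the valency of its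
initial vertex. -/
structure IsNagaoRay (x : ℕ → VQ) (e : ℕ → EQ) : Prop where
  src_eq : ∀ k, Q.src (e k) = x k
  tgt_eq : ∀ k, Q.tgt (e k) = x (k + 1)
  ind_out : ∀ k, Q.ind (e (k + 1)) = 1
  ind_in : ∀ k, Q.ind (Q.rev (e k)) + 1 = Q.deg (x (k + 1))

/-- `Q` has a finite subgraph, with vertex set `FV` and edge set `FE`, whose complement is a
disjoint union of `n` open Nagao rays: the `i`-th one consists of the vertices
`x i 1, x i 2, …` and of all edges, in both orientations, of the Nagao ray `(x i, e i)`,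
whose origin `x i 0` lies in the finite subgraph. (As the vertices `x i (k + 1)` are
pairwise distinct, so are the edges.) -/
def IsGeometricallyFinite : Prop :=
  ∃ (FV : Set VQ) (FE : Set EQ) (n : ℕ) (x : Fin n → ℕ → VQ) (e : Fin n → ℕ → EQ),
    FV.Finite ∧ FE.Finite ∧ (∀ a ∈ FE, Q.src a ∈ FV ∧ Q.rev a ∈ FE) ∧
    (∀ i, Q.IsNagaoRay (x i) (e i)) ∧ (∀ i, x i 0 ∈ FV) ∧
    (Function.Injective fun p : Fin n × ℕ => x p.1 (p.2 + 1)) ∧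
    (∀ v, v ∉ FV ↔ ∃ i k, v = x i (k + 1)) ∧
    (∀ a, a ∉ FE ↔ ∃ i k, a = e i k ∨ a = Q.rev (e i k))

end EdgeIndexedGraph

/-! ### The edge-indexed graph of a group of tree automorphisms -/

/-- The vertices of `Γ \ T`. -/
abbrev QuotVert {V : Type*} {T : SimpleGraph V} (Γ : Subgroup (TreeAut T)) : Type _ :=
  MulAction.orbitRel.Quotient Γ V

/-- The oriented edges of `Γ \ T`. -/
abbrev QuotEdge {V : Type*} {T : SimpleGraph V} (Γ : Subgroup (TreeAut T)) : Type _ :=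
  MulAction.orbitRel.Quotient Γ T.Dart

/-- The projection `π : VT → VQ`. -/
def quotVert {V : Type*} {T : SimpleGraph V} (Γ : Subgroup (TreeAut T)) (v : V) : QuotVert Γ :=
  Quotient.mk _ v

/-- The projection `π : ET → EQ`. -/
def quotEdge {V : Type*} {T : SimpleGraph V} (Γ : Subgroup (TreeAut T)) (e : T.Dart) :
    QuotEdge Γ :=
  Quotient.mk _ e

/-- The index `[Γ_{∂₀ e} : Γ_e]` of an oriented edge `e` of `T`. -/
noncomputable def liftInd {V : Type*} {T : SimpleGraph V} (Γ : Subgroup (TreeAut T))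
    (e : T.Dart) : ℕ :=
  (MulAction.stabilizer Γ e).relIndex (MulAction.stabilizer Γ e.fst)

theorem liftInd_smul {V : Type*} {T : SimpleGraph V} (Γ : Subgroup (TreeAut T))
    (γ : Γ) (e : T.Dart) : liftInd Γ (γ • e) = liftInd Γ e := by
  have h : (γ • e).fst = γ • e.fst := rfl
  unfold liftInd
  rw [h, MulAction.stabilizer_smul_eq_stabilizer_map_conj,
    MulAction.stabilizer_smul_eq_stabilizer_map_conj]
  exact Subgroup.relIndex_map_map_of_injective _ _ (MulAut.conj γ).injective

/-- The edge-indexed graph `(Q, ind)` of `Γ`, with `Q = Γ \ T` and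
`ind (π e) = [Γ_{∂₀ e} : Γ_e]`. -/
noncomputable def quotGraph {V : Type*} {T : SimpleGraph V} (Γ : Subgroup (TreeAut T)) :
    EdgeIndexedGraph (QuotVert Γ) (QuotEdge Γ) where
  src := Quotient.lift (fun e => quotVert Γ e.fst) (by
    rintro _ b ⟨γ, rfl⟩
    exact Quotient.sound ⟨γ, rfl⟩)
  tgt := Quotient.lift (fun e => quotVert Γ e.snd) (by
    rintro _ b ⟨γ, rfl⟩
    exact Quotient.sound ⟨γ, rfl⟩)
  rev := Quotient.lift (fun e => quotEdge Γ e.symm) (by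
    rintro _ b ⟨γ, rfl⟩
    exact Quotient.sound ⟨γ, rfl⟩)
  ind := Quotient.lift (liftInd Γ) (by
    rintro _ b ⟨γ, rfl⟩
    exact liftInd_smul Γ γ b)
  rev_rev := by
    rintro ⟨e⟩
    exact congrArg (quotEdge Γ) e.symm_symm
  src_rev := by
    rintro ⟨e⟩
    rfl

/-! ### Counting -/

/-- `N(R)`, the number of elements `γ` of `Γ` with `d(γ o, o) ≤ R`. -/
noncomputable def latticeCount {V : Type*} {T : SimpleGraph V} (Γ : Subgroup (TreeAut T)) (o : V)
    (R : ℕ) : ℕ :=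
  {γ : TreeAut T | γ ∈ Γ ∧ T.dist (γ • o) o ≤ R}.ncard

/-- `B_T(R)`, the number of vertices whose distance from `o` is even and at most `R`. -/
noncomputable def evenBallCard {V : Type*} (T : SimpleGraph V) (o : V) (R : ℕ) : ℕ :=
  {v : V | Even (T.dist v o) ∧ T.dist v o ≤ R}.ncard

/-! Let A be the adjacency operator on functions on the vertices of Q, that is, on Γ-invariant
functions on the vertices of T, and give the vertex a the mass μ(a) = 1/|Γ_a|. Mass transport makes
A symmetric for L²(μ) (`vertMass_mul_vertKernel`). The number of points of the orbit Γo on the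
sphere of radius 2k around o is the value at o of S_k δ_o, where S_k sums a function over such
spheres. On the colour class of o, S_k is a polynomial in A² determined by a three-term recurrence
(`sum_sphere_sphere`, `quotKernel_sphereOp_apply`). Projecting δ_o to the constants of that class
gives the main term, μ(o)/μ(V'Q) times the size of the sphere; what remains is a function of mean
zero.

The error is controlled by a spectral gap. Along a Nagao ray the masses at least halve at each step,
so a Hardy inequality holds on each ray. As only finitely many vertices lie off the rays, a Poincaré
inequality follows (`poincare_of_rays`). It bounds A² on functions of mean zero by (p+1)(q+1) - ε,
where p+1 and q+1 are the two valencies (`spectral_gap`). The characteristic roots of the recurrence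
are then at most max(p, q, pq - ε) < pq in modulus (`norm_root_le`), while the sphere of radius 2k
has at least (pq)^k points. Summing over k and dividing gives the exponential rate.

For the constant, Aut(T) is unimodular because it is transitive on pairs of vertices with given
distance and colours (`exists_treeAut_smul_eq`). Cutting a fundamental domain D according to the
point h⁻¹o yields m(D) = m(G_o) · ∑ 1/|Γ_v|, the sum being over the colour class of o
(`measure_fundamentalDomain`), which is V'Q by `even_dist_quotGraph_iff`. Each orbit point is γo for
|Γ_o| elements γ, and this factor cancels μ(o). -/

/-! ### Linear recurrences of order two -/

/-- At the extreme values the polynomial factors: as (z - 1)(z - pq) for τ = pq + 1 and as (z + p)(z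
+ q) for τ = -(p + q). Comparison with the first excludes large positive roots, the ε moving the
bound below pq; comparison with the second excludes large negative ones. Non-real roots are
conjugate, so their modulus is √(pq). -/
theorem norm_root_le {p q ε τ : ℝ} (hp : 2 ≤ p) (hq : 2 ≤ q) (hε : 0 < ε) (h₁ : -(p + q) ≤ τ)
    (h₂ : τ ≤ p * q + 1 - ε) {z : ℂ} (hz : z * z - τ * z + (p * q : ℝ) = 0) :
    ‖z‖ ≤ max (max p q) (p * q - ε) := by
  have hre := congrArg Complex.re hz
  have him := congrArg Complex.im hz
  simp only [Complex.add_re, Complex.sub_re, Complex.mul_re, Complex.ofReal_re, Complex.ofReal_im,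
    Complex.add_im, Complex.sub_im, Complex.mul_im, Complex.zero_re, Complex.zero_im] at hre him
  set x := z.re
  set y := z.im
  have hM : p * q ≤ (max p q) ^ 2 := by
    have := le_max_left p q
    have := le_max_right p q
    nlinarith
  have hM2 : 2 ≤ max p q := hp.trans (le_max_left _ _)
  by_cases hy : y = 0
  · have hzx : z = (x : ℂ) := Complex.ext rfl (by simpa using hy)
    rw [hzx, Complex.norm_real, Real.norm_eq_abs]
    rw [hy] at hre
    have hre' : x * x - τ * x + p * q = 0 := by linarith
    rcases le_or_gt 0 x with hx | hx
    · rw [abs_of_nonneg hx]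
      by_contra! hlt
      have h3 : max p q < x := (le_max_left _ _).trans_lt hlt
      have h4 : p * q - ε < x := (le_max_right _ _).trans_lt hlt
      have h5 : x * x + p * q ≤ (p * q + 1 - ε) * x := by nlinarith
      have h6 : (p * q - x) * (x - 1) < ε * (x - 1) :=
        mul_lt_mul_of_pos_right (by linarith) (by linarith)
      nlinarith
    · rw [abs_of_neg hx]
      refine le_trans ?_ (le_max_left _ _)
      by_contra! hlt
      have h3 := (le_max_left p q).trans_lt hlt
      have h4 := (le_max_right p q).trans_lt hlt
      nlinarith [mul_pos (sub_pos.2 h3) (sub_pos.2 h4)]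
  · have hτ : τ = 2 * x := by
      have : y * (2 * x - τ) = 0 := by linarith
      rcases mul_eq_zero.1 this with h | h
      · exact absurd h hy
      · linarith
    have hn : ‖z‖ ^ 2 = p * q := by
      rw [Complex.sq_norm, Complex.normSq_apply]
      change x * x + y * y = p * q
      rw [hτ] at hre
      linarith
    refine le_trans ?_ (le_max_left _ _)
    exact abs_le_of_sq_le_sq' (by rw [hn]; exact hM) (by linarith) |>.2

/-- With characteristic roots z and w, the sequence u (k + 1) - z u k is geometric of ratio w.
Solving the remaining first-order recurrence adds up k + 1 terms of comparable size, so the bound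
also covers a double root. The recurrence is required only up to `n` because the sequences to which
this is applied satisfy it only on a finite window. -/
theorem abs_le_of_linear_recurrence {p q ε τ : ℝ} (hp : 2 ≤ p) (hq : 2 ≤ q)
    (hε : 0 < ε) (h₁ : -(p + q) ≤ τ) (h₂ : τ ≤ p * q + 1 - ε) (u : ℕ → ℝ) (n : ℕ)
    (hu : ∀ k, k + 2 ≤ n → u (k + 2) = τ * u (k + 1) - p * q * u k) :
    ∀ k ≤ n, |u k| ≤ (k + 1) * max (max p q) (p * q - ε) ^ k * (|u 0| + |u 1|) := by
  set r := max (max p q) (p * q - ε) with hr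
  have hr2 : 2 ≤ r := (hp.trans (le_max_left _ _)).trans (le_max_left _ _)
  obtain ⟨z, hz⟩ : ∃ z : ℂ, z * z - τ * z + (p * q : ℝ) = 0 := by
    obtain ⟨s, hs⟩ := IsAlgClosed.exists_pow_nat_eq ((τ : ℂ) ^ 2 - 4 * (p * q : ℝ)) (n := 2)
      (by norm_num)
    exact ⟨(τ + s) / 2, by linear_combination hs / 4⟩
  set w : ℂ := τ - z with hw
  have hw' : w * w - τ * w + (p * q : ℝ) = 0 := by rw [hw]; linear_combination hz
  have hzw : z * w = (p * q : ℝ) := by rw [hw]; linear_combination -hz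
  have hzr : ‖z‖ ≤ r := norm_root_le hp hq hε h₁ h₂ hz
  have hwr : ‖w‖ ≤ r := norm_root_le hp hq hε h₁ h₂ hw'
  set A := |u 0| + |u 1| with hA
  have hA0 : 0 ≤ A := by positivity
  have step : ∀ k, k + 1 ≤ n → ‖(u (k + 1) : ℂ) - z * u k‖ ≤ r ^ (k + 1) * A := by
    intro k
    induction k with
    | zero =>
      intro _
      calc ‖(u (0 + 1) : ℂ) - z * u 0‖ ≤ ‖(u 1 : ℂ)‖ + ‖z * u 0‖ := norm_sub_le _ _
        _ = |u 1| + ‖z‖ * |u 0| := by simp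
        _ ≤ r * |u 1| + r * |u 0| := by
          have := abs_nonneg (u 1)
          have := abs_nonneg (u 0)
          gcongr
          nlinarith
        _ = r ^ (0 + 1) * A := by rw [hA]; ring
    | succ k ih =>
      intro hk
      have e : (u (k + 1 + 1) : ℂ) - z * u (k + 1) = w * (u (k + 1) - z * u k) := by
        rw [hu k hk]
        push_cast
        have : (p : ℂ) * q = z * w := by rw [hzw]; push_cast; ring
        rw [this, hw]; ring
      rw [e, norm_mul, pow_succ' r, mul_assoc]
      exact mul_le_mul hwr (ih (by omega)) (norm_nonneg _) (by linarith)
  intro k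
  induction k with
  | zero => intro _; simp [hA]
  | succ k ih =>
    intro hk
    have e : (u (k + 1) : ℂ) = (u (k + 1) - z * u k) + z * u k := by ring
    calc |u (k + 1)| = ‖(u (k + 1) : ℂ)‖ := by simp
      _ = ‖((u (k + 1) : ℂ) - z * u k) + z * u k‖ := by rw [← e]
      _ ≤ ‖(u (k + 1) : ℂ) - z * u k‖ + ‖z * u k‖ := norm_add_le _ _
      _ ≤ r ^ (k + 1) * A + r * ((k + 1) * r ^ k * A) := by
        rw [norm_mul]
        refine add_le_add (step k hk) (mul_le_mul hzr ?_ (norm_nonneg _) (by linarith))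
        simpa using ih (by omega)
      _ = ((k + 1 : ℕ) + 1) * r ^ (k + 1) * A := by push_cast; ring

/-! ### Three-term recurrences for symmetric operators -/

/-- A spectral estimate for sequences generated by a three-term recurrence from a symmetric
operator whose quadratic form is bounded between `0` and `b`. -/
theorem abs_inner_le_of_operator_recurrence {E : Type*} [NormedAddCommGroup E]
    [InnerProductSpace ℝ E] (X : E →ₗ[ℝ] E) (hX : X.IsSymmetric) (H : Submodule ℝ E) {b : ℝ}
    (hb : ∀ φ ∈ H, 0 ≤ inner ℝ (X φ) φ ∧ inner ℝ (X φ) φ ≤ b * ‖φ‖ ^ 2)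
    (φ : E) (x : ℕ → E) (hφ : φ ∈ H) (hx : ∀ k, x k ∈ H) (s t a₀ a₁ : ℝ)
    (h0 : x 0 = a₀ • φ) (h1 : x 1 = X φ - a₁ • φ)
    (hrec : ∀ k, x (k + 2) = X (x (k + 1)) - s • x (k + 1) - t • x k) (B : ℕ → ℝ)
    (hB : ∀ τ : ℝ, 0 ≤ τ → τ ≤ b → ∀ (u : ℕ → ℝ) (n : ℕ),
      (∀ k, k + 2 ≤ n → u (k + 2) = (τ - s) * u (k + 1) - t * u k) →
      ∀ k ≤ n, |u k| ≤ B k * (|u 0| + |u 1|)) (hB0 : ∀ k, 0 ≤ B k) (n : ℕ) :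
    |inner ℝ (x n) φ| ≤ B n * (|a₀| + (b + |a₁|)) * ‖φ‖ ^ 2 := by
  classical
  -- `E` need not be complete and `X` need not have eigenvectors, so `X` is compressed to the span
  -- of finitely many terms. For vectors of `K` the compression has the same inner products as `X`;
  -- hence the coefficients of the `x k` in its eigenbasis satisfy the scalar recurrence as far as
  -- needed, with eigenvalues in [0, b] because `K ≤ H`.
  let S : Set E := insert φ (x '' {k | k ≤ n + 1})
  have hSfin : S.Finite := ((Set.finite_le_nat _).image _).insert _
  let K : Submodule ℝ E := Submodule.span ℝ S
  have hKH : K ≤ H := by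
    refine Submodule.span_le.2 ?_
    rintro y (rfl | ⟨k, -, rfl⟩)
    exacts [hφ, hx k]
  have : FiniteDimensional ℝ K := FiniteDimensional.span_of_finite ℝ hSfin
  have hφK : φ ∈ K := Submodule.subset_span (Set.mem_insert _ _)
  have hxK : ∀ k ≤ n + 1, x k ∈ K := fun k hk =>
    Submodule.subset_span (Set.mem_insert_of_mem _ ⟨k, hk, rfl⟩)
  let t' : K →ₗ[ℝ] K := K.orthogonalProjectionOnto.toLinearMap ∘ₗ X ∘ₗ K.subtype
  have ht' : ∀ y z : K, inner ℝ (t' y) z = inner ℝ (X y) (z : E) := by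
    intro y z
    change inner ℝ (K.orthogonalProjectionOnto (X y)) z = _
    rw [Submodule.inner_orthogonalProjectionOnto_eq_of_mem_right]
  have hsym : t'.IsSymmetric := by
    intro y z
    rw [ht', real_inner_comm (t' z) y, ht', hX y z, real_inner_comm]
  let bs := hsym.eigenvectorBasis rfl
  let ev := hsym.eigenvalues rfl
  have hev : ∀ i (y : K), inner ℝ (X y) (bs i : E) = ev i * inner ℝ (y : E) (bs i : E) := by
    intro i y
    rw [← ht', hsym, hsym.apply_eigenvectorBasis, inner_smul_right]
    rfl
  have hev0 : ∀ i, 0 ≤ ev i ∧ ev i ≤ b := by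
    intro i
    have h1 := hb (bs i) (hKH (bs i).2)
    have h2 : ‖(bs i : E)‖ = 1 := bs.orthonormal.1 i
    rw [hev, real_inner_self_eq_norm_sq, h2] at h1
    simpa using h1
  have hexp : ∀ y z : K, inner ℝ (y : E) (z : E)
      = ∑ i, inner ℝ (y : E) (bs i : E) * inner ℝ (z : E) (bs i : E) := by
    intro y z
    have := bs.sum_inner_mul_inner y z
    rw [← Submodule.coe_inner, ← this]
    refine Finset.sum_congr rfl fun i _ => ?_
    rw [real_inner_comm z (bs i)]
    rfl
  have hbound : ∀ i, |inner ℝ (x n) (bs i : E)|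
      ≤ B n * (|a₀| + (b + |a₁|)) * |inner ℝ φ (bs i : E)| := by
    intro i
    have := hB (ev i) (hev0 i).1 (hev0 i).2 (fun k => inner ℝ (x k) (bs i : E)) (n + 1) (by
      intro k hk
      rw [hrec, inner_sub_left, inner_sub_left, inner_smul_left, inner_smul_left,
        hev i ⟨x (k + 1), hxK _ (by omega)⟩]
      simp; ring) n (by omega)
    refine this.trans ?_
    rw [mul_assoc]
    refine mul_le_mul_of_nonneg_left ?_ (hB0 n)
    have e0 : inner ℝ (x 0) (bs i : E) = a₀ * inner ℝ φ (bs i : E) := by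
      rw [h0, inner_smul_left]; simp
    have e1 : inner ℝ (x 1) (bs i : E) = (ev i - a₁) * inner ℝ φ (bs i : E) := by
      rw [h1, inner_sub_left, inner_smul_left, hev i ⟨φ, hφK⟩]; simp; ring
    rw [e0, e1, abs_mul, abs_mul, ← add_mul]
    refine mul_le_mul_of_nonneg_right (add_le_add le_rfl ?_) (abs_nonneg _)
    refine (abs_sub _ _).trans (add_le_add ?_ le_rfl)
    rw [abs_of_nonneg (hev0 i).1]
    exact (hev0 i).2
  rw [hexp ⟨x n, hxK n (by omega)⟩ ⟨φ, hφK⟩, ← real_inner_self_eq_norm_sq,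
    hexp ⟨φ, hφK⟩ ⟨φ, hφK⟩, Finset.mul_sum]
  refine (Finset.abs_sum_le_sum_abs _ _).trans (Finset.sum_le_sum fun i _ => ?_)
  rw [abs_mul]
  refine (mul_le_mul_of_nonneg_right (hbound i) (abs_nonneg _)).trans (le_of_eq ?_)
  rw [mul_assoc, abs_mul_abs_self]

/-! ### Sums over orbits and the mass transport principle -/

section Orbits

variable {G X : Type*} [Group G] [MulAction G X]

/-- The mass `1 / |G_x|` of the orbit of `x`. -/
noncomputable def orbitMass (G : Type*) {X : Type*} [Group G] [MulAction G X] (x : X) : ℝ≥0∞ :=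
  (ENat.card (MulAction.stabilizer G x) : ℝ≥0∞)⁻¹

/-- The fibres of g ↦ g • x over the orbit are the left cosets of the stabilizer. -/
theorem tsum_smul_eq_card_mul (x : X) (h : X → ℝ≥0∞) :
    ∑' g : G, h (g • x) =
      (ENat.card (MulAction.stabilizer G x) : ℝ≥0∞) * ∑' y : MulAction.orbit G x, h y := by
  let f : G → MulAction.orbit G x := fun g => ⟨g • x, g, rfl⟩
  rw [← (Equiv.sigmaFiberEquiv f).tsum_eq, ENNReal.tsum_sigma', ← ENNReal.tsum_mul_left]
  refine tsum_congr fun y => ?_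
  obtain ⟨_, g₀, rfl⟩ := y
  have e : {g : G // f g = ⟨g₀ • x, g₀, rfl⟩} ≃ MulAction.stabilizer G x :=
    { toFun := fun g => ⟨g₀⁻¹ * g.1, by
        have := congrArg Subtype.val g.2
        change g.1 • x = g₀ • x at this
        rw [MulAction.mem_stabilizer_iff, mul_smul, this, inv_smul_smul]⟩
      invFun := fun s => ⟨g₀ * s.1, Subtype.ext (by
        change (g₀ * s.1) • x = g₀ • x
        rw [mul_smul, s.2])⟩
      left_inv := fun g => by simp
      right_inv := fun s => by simp }
  have : ∀ g : {g : G // f g = ⟨g₀ • x, g₀, rfl⟩},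
      h ((Equiv.sigmaFiberEquiv f ⟨⟨g₀ • x, g₀, rfl⟩, g⟩ : G) • x) = h (g₀ • x) := by
    intro g
    exact congrArg h (congrArg Subtype.val g.2)
  rw [tsum_congr this, ENNReal.tsum_const, ENat.card_congr e]

theorem tsum_eq_tsum_orbitMass [∀ x : X, Finite (MulAction.stabilizer G x)] (h : X → ℝ≥0∞) :
    ∑' x, h x = ∑' a : MulAction.orbitRel.Quotient G X,
      orbitMass G a.out * ∑' g : G, h (g • a.out) := by
  rw [← (MulAction.selfEquivSigmaOrbits G X).symm.tsum_eq, ENNReal.tsum_sigma']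
  refine tsum_congr fun a => ?_
  rw [tsum_smul_eq_card_mul, orbitMass, ← mul_assoc, ENNReal.inv_mul_cancel, one_mul]
  · refine tsum_congr fun y => ?_
    congr 1
  · rw [ENat.card_eq_coe_natCard]
    exact_mod_cast Nat.card_pos.ne'
  · rw [ENat.card_eq_coe_natCard]
    exact ENNReal.natCast_ne_top _

/-- The mass transport principle. -/
theorem mass_transport [∀ x : X, Finite (MulAction.stabilizer G x)] (F : X → X → ℝ≥0∞)
    (hF : ∀ (g : G) x y, F (g • x) (g • y) = F x y) :
    ∑' a : MulAction.orbitRel.Quotient G X, orbitMass G a.out * ∑' y, F a.out y =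
      ∑' a : MulAction.orbitRel.Quotient G X, orbitMass G a.out * ∑' x, F x a.out := by
  have h1 : ∀ a : MulAction.orbitRel.Quotient G X, orbitMass G a.out * ∑' y, F a.out y =
      ∑' b : MulAction.orbitRel.Quotient G X,
        orbitMass G a.out * orbitMass G b.out * ∑' g : G, F a.out (g • b.out) := by
    intro a
    rw [tsum_eq_tsum_orbitMass (G := G), ← ENNReal.tsum_mul_left]
    simp_rw [mul_assoc]
  have h2 : ∀ a : MulAction.orbitRel.Quotient G X, orbitMass G a.out * ∑' x, F x a.out =
      ∑' b : MulAction.orbitRel.Quotient G X,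
        orbitMass G b.out * orbitMass G a.out * ∑' g : G, F b.out (g • a.out) := by
    intro a
    rw [tsum_eq_tsum_orbitMass (G := G), ← ENNReal.tsum_mul_left]
    refine tsum_congr fun b => ?_
    rw [← mul_assoc, mul_comm (orbitMass G a.out)]
    congr 1
    -- Invariance turns F (g⁻¹ • b) a into F b (g • a); both sides then become the same double sum
    -- over pairs of orbits, in opposite orders.
    rw [← (Equiv.inv G).tsum_eq]
    refine tsum_congr fun g => ?_
    rw [← hF g, Equiv.inv_apply, smul_inv_smul]
  simp_rw [h1, h2]
  exact ENNReal.tsum_comm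

end Orbits

/-! ### Geometry of trees -/

namespace SimpleGraph.IsTree

variable {V : Type*} {T : SimpleGraph V}

/-- A neighbour of `v` closer to `w` is the second vertex of a geodesic from `v` to `w`, and paths
in a tree are unique. -/
theorem existsUnique_adj_dist (hT : T.IsTree) {v w : V} (h : v ≠ w) :
    ∃! u, T.Adj v u ∧ T.dist u w + 1 = T.dist v w := by
  obtain ⟨p, hp⟩ := hT.connected.exists_walk_length_eq_dist v w
  have key : ∀ u, T.Adj v u → T.dist u w + 1 = T.dist v w →
      ∃ (q : T.Walk v w), q.IsPath ∧ q.snd = u := by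
    intro u hu hd
    obtain ⟨q, hq⟩ := hT.connected.exists_walk_length_eq_dist u w
    refine ⟨Walk.cons hu q, Walk.isPath_of_length_eq_dist _ ?_, by simp⟩
    rw [Walk.length_cons, hq, hd]
  cases p with
  | nil => exact absurd rfl h
  | @cons _ u _ hu q =>
    refine ⟨u, ⟨hu, ?_⟩, ?_⟩
    · rw [Walk.length_cons] at hp
      have h1 := dist_le q
      have h2 := hT.connected.dist_triangle (u := v) (v := u) (w := w)
      rw [dist_eq_one_iff_adj.2 hu] at h2
      omega
    · rintro u' ⟨hu', hd'⟩
      have hd : T.dist u w + 1 = T.dist v w := by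
        rw [Walk.length_cons] at hp
        have h1 := dist_le q
        have h2 := hT.connected.dist_triangle (u := v) (v := u) (w := w)
        rw [dist_eq_one_iff_adj.2 hu] at h2
        omega
      obtain ⟨q₁, h₁, rfl⟩ := key u hu hd
      obtain ⟨q₂, h₂, rfl⟩ := key u' hu' hd'
      rw [(hT.existsUnique_path v w).unique h₁ h₂]

open Classical in
/-- The neighbour of `v` in the direction of `w`. -/
noncomputable def toward (hT : T.IsTree) (v w : V) : V :=
  if h : v ≠ w then (hT.existsUnique_adj_dist h).choose else v

theorem adj_toward (hT : T.IsTree) {v w : V} (h : v ≠ w) : T.Adj v (hT.toward v w) := by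
  rw [toward, dif_pos h]
  exact (hT.existsUnique_adj_dist h).choose_spec.1.1

theorem dist_toward (hT : T.IsTree) {v w : V} (h : v ≠ w) :
    T.dist (hT.toward v w) w + 1 = T.dist v w := by
  rw [toward, dif_pos h]
  exact (hT.existsUnique_adj_dist h).choose_spec.1.2

theorem eq_toward (hT : T.IsTree) {u v w : V} (h : T.Adj v u)
    (hd : T.dist u w + 1 = T.dist v w) : u = hT.toward v w := by
  have hvw : v ≠ w := by rintro rfl; simp at hd
  exact (hT.existsUnique_adj_dist hvw).unique ⟨h, hd⟩
    ⟨hT.adj_toward hvw, hT.dist_toward hvw⟩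

theorem dist_adj_cases (hT : T.IsTree) {u v : V} (h : T.Adj v u) (w : V) :
    T.dist u w + 1 = T.dist v w ∨ T.dist u w = T.dist v w + 1 := by
  have := hT.dist_eq_dist_add_one_of_adj w h
  rw [dist_comm (u := w), dist_comm (u := w)] at this
  omega

theorem dist_adj_of_ne_toward (hT : T.IsTree) {u v w : V} (h : T.Adj v u)
    (hu : u ≠ hT.toward v w) : T.dist u w = T.dist v w + 1 :=
  (hT.dist_adj_cases h w).resolve_left fun hd => hu (hT.eq_toward h hd)

end SimpleGraph.IsTree

namespace SimpleGraph

variable {V : Type*} {T : SimpleGraph V}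

theorem finite_sphere (hT : T.Connected) (hfin : ∀ v, (T.neighborSet v).Finite) (v : V) (n : ℕ) :
    {w | T.dist v w = n}.Finite := by
  induction n with
  | zero =>
    refine (Set.finite_singleton v).subset fun w hw => ?_
    exact (hT.dist_eq_zero_iff.1 hw).symm
  | succ n ih =>
    refine (ih.biUnion fun u _ => hfin u).subset fun w hw => ?_
    obtain ⟨p, hp⟩ := hT.exists_walk_length_eq_dist w v
    rw [dist_comm, hw] at hp
    cases p with
    | nil => simp at hp
    | @cons _ u _ hu q =>
      rw [Walk.length_cons] at hp
      have h1 := dist_le q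
      have h2 := hT.dist_triangle (u := w) (v := u) (w := v)
      rw [dist_eq_one_iff_adj.2 hu, dist_comm (u := w), hw] at h2
      refine Set.mem_biUnion (x := u) ?_ hu.symm
      change T.dist v u = n
      rw [dist_comm]
      omega

open Classical in
/-- The sphere of radius `n` around `v`; empty when it is infinite. -/
noncomputable def sphere (T : SimpleGraph V) (v : V) (n : ℕ) : Finset V :=
  if h : {w | T.dist v w = n}.Finite then h.toFinset else ∅

theorem mem_sphere (hT : T.Connected) (hfin : ∀ v, (T.neighborSet v).Finite) {v w : V} {n : ℕ} :
    w ∈ T.sphere v n ↔ T.dist v w = n := by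
  rw [sphere, dif_pos (finite_sphere hT hfin v n)]
  simp

theorem mem_sphere_one (hT : T.Connected) (hfin : ∀ v, (T.neighborSet v).Finite) {v w : V} :
    w ∈ T.sphere v 1 ↔ T.Adj v w := by
  rw [mem_sphere hT hfin, dist_eq_one_iff_adj]

theorem sphere_zero (hT : T.Connected) (hfin : ∀ v, (T.neighborSet v).Finite) (v : V) :
    T.sphere v 0 = {v} := by
  ext w
  rw [mem_sphere hT hfin, hT.dist_eq_zero_iff, Finset.mem_singleton, eq_comm]

-- A vertex w at distance n + 1 from a neighbour of v is at distance n + 2 or n from v. In the first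
-- case only the neighbour towards w qualifies, in the second every neighbour except that one. For n
-- = 0 there is no exception, since w = v. This is the source of the recurrence for the sphere
-- operators and of its irregular beginning.
open Classical in
theorem sum_sphere_sphere (hT : T.IsTree) (hfin : ∀ v, (T.neighborSet v).Finite) (f : V → ℝ)
    (v : V) (n : ℕ) :
    ∑ u ∈ T.sphere v 1, ∑ w ∈ T.sphere u (n + 1), f w =
      ∑ w ∈ T.sphere v (n + 2), f w +
        ((T.sphere v 1).card - if n = 0 then 0 else 1) * ∑ w ∈ T.sphere v n, f w := by
  have hc := hT.connected
  have hdisj : Disjoint (T.sphere v (n + 2)) (T.sphere v n) := by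
    rw [Finset.disjoint_left]
    intro w h1 h2
    rw [mem_sphere hc hfin] at h1 h2
    omega
  rw [Finset.sum_comm' (t' := T.sphere v (n + 2) ∪ T.sphere v n)
    (s' := fun w => (T.sphere v 1).filter fun u => T.dist u w = n + 1),
    Finset.sum_union hdisj, Finset.mul_sum]
  · congr 1
    · refine Finset.sum_congr rfl fun w hw => ?_
      rw [mem_sphere hc hfin] at hw
      have hvw : v ≠ w := by rintro rfl; simp at hw
      have : (T.sphere v 1).filter (fun u => T.dist u w = n + 1) = {hT.toward v w} := by
        ext u
        rw [Finset.mem_filter, mem_sphere_one hc hfin, Finset.mem_singleton]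
        constructor
        · rintro ⟨h1, h2⟩
          exact hT.eq_toward h1 (by omega)
        · rintro rfl
          exact ⟨hT.adj_toward hvw, by have := hT.dist_toward hvw; omega⟩
      rw [this, Finset.sum_singleton]
    · refine Finset.sum_congr rfl fun w hw => ?_
      rw [mem_sphere hc hfin] at hw
      rw [Finset.sum_const, nsmul_eq_mul]
      congr 1
      split_ifs with hn
      · have hvw : v = w := hc.dist_eq_zero_iff.1 (hw.trans hn)
        subst hvw
        rw [sub_zero, Finset.filter_true_of_mem]
        intro u hu
        rw [mem_sphere_one hc hfin] at hu
        rw [hn, dist_eq_one_iff_adj.2 hu.symm]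
      · have hvw : v ≠ w := by rintro rfl; simp at hw; omega
        have : (T.sphere v 1).filter (fun u => T.dist u w = n + 1)
            = (T.sphere v 1).erase (hT.toward v w) := by
          ext u
          rw [Finset.mem_filter, mem_sphere_one hc hfin, Finset.mem_erase, mem_sphere_one hc hfin]
          constructor
          · rintro ⟨h1, h2⟩
            refine ⟨?_, h1⟩
            rintro rfl
            have := hT.dist_toward hvw
            omega
          · rintro ⟨h1, h2⟩
            exact ⟨h2, by rw [hT.dist_adj_of_ne_toward h2 h1, hw]⟩
        have hmem : hT.toward v w ∈ T.sphere v 1 :=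
          (mem_sphere_one hc hfin).2 (hT.adj_toward hvw)
        rw [this, Finset.card_erase_of_mem hmem, Nat.cast_sub (Finset.card_pos.2 ⟨_, hmem⟩)]
        simp
  · intro u w
    rw [Finset.mem_filter, Finset.mem_union, mem_sphere_one hc hfin]
    simp only [mem_sphere hc hfin]
    constructor
    · rintro ⟨h1, h2⟩
      exact ⟨⟨h1, h2⟩, by have := hT.dist_adj_cases h1 w; omega⟩
    · rintro ⟨h1, -⟩
      exact h1

end SimpleGraph

/-! ### Extension of partial isometries of biregular trees -/

section Extension

variable {V : Type*} {T : SimpleGraph V}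

/-- The map of the vertices at distance `n` from `o` that sends `o` to `o'` and a vertex `v` with
parent `u` to `σ u u' v`, where `u'` is the image of `u`. -/
noncomputable def levelMap (hT : T.IsTree) (o o' : V) (σ : V → V → V → V) : ℕ → V → V
  | 0, _ => o'
  | n + 1, v => σ (hT.toward v o) (levelMap hT o o' σ n (hT.toward v o)) v

/-- `σ a b` maps the children of `a` with respect to the root `o` injectively to the children of
`b` with respect to the root `o'`, with left inverse `τ b a`, if `a` and `b` have the same
level and colour. -/
def IsChildMap (c : T.Coloring Bool) (o o' : V) (σ τ : V → V → V → V) : Prop :=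
  ∀ a b v, T.dist a o = T.dist b o' → c a = c b → T.Adj a v → T.dist v o = T.dist a o + 1 →
    T.Adj b (σ a b v) ∧ T.dist (σ a b v) o' = T.dist b o' + 1 ∧ τ b a (σ a b v) = v

theorem color_eq_of_adj_of_adj (c : T.Coloring Bool) {a a' b b' : V} (h : c a = c b)
    (ha : T.Adj a a') (hb : T.Adj b b') : c a' = c b' := by
  have h1 := c.valid ha
  have h2 := c.valid hb
  revert h h1 h2
  cases c a <;> cases c b <;> cases c a' <;> cases c b' <;> simp

/-- The parent of the image of a vertex is the image of its parent. So the inverse child map undoes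
the last step, and induction on the level undoes the others. -/
theorem levelMap_spec (hT : T.IsTree) (c : T.Coloring Bool) {o o' : V} {σ τ : V → V → V → V}
    (ho : c o = c o') (hσ : IsChildMap c o o' σ τ) :
    ∀ n v, T.dist v o = n → T.dist (levelMap hT o o' σ n v) o' = n ∧
      c (levelMap hT o o' σ n v) = c v ∧
      levelMap hT o' o τ n (levelMap hT o o' σ n v) = v := by
  intro n
  induction n with
  | zero =>
    intro v hv
    have := hT.connected.dist_eq_zero_iff.1 hv
    subst this
    simp [levelMap, ho]
  | succ n ih =>
    intro v hv
    have hvo : v ≠ o := by rintro rfl; simp at hv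
    have hadj := hT.adj_toward hvo
    have hd := hT.dist_toward hvo
    obtain ⟨h1, h2, h3⟩ := ih (hT.toward v o) (by omega)
    obtain ⟨k1, k2, k3⟩ := hσ (hT.toward v o) (levelMap hT o o' σ n (hT.toward v o)) v
      (by omega) h2.symm hadj.symm (by omega)
    have ht : levelMap hT o o' σ n (hT.toward v o)
        = hT.toward (levelMap hT o o' σ (n + 1) v) o' := by
      refine hT.eq_toward k1.symm ?_
      change _ = T.dist (σ _ _ v) o'
      rw [k2]
    refine ⟨?_, ?_, ?_⟩
    · change T.dist (σ _ _ v) o' = _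
      rw [k2, h1]
    · exact color_eq_of_adj_of_adj c h2 k1 hadj.symm
    · change τ (hT.toward (levelMap hT o o' σ (n + 1) v) o') (levelMap hT o' o τ n
        (hT.toward (levelMap hT o o' σ (n + 1) v) o')) (σ _ _ v) = v
      rw [← ht, h3, k3]

theorem levelMap_adj (hT : T.IsTree) (c : T.Coloring Bool) {o o' : V} {σ τ : V → V → V → V}
    (ho : c o = c o') (hσ : IsChildMap c o o' σ τ) {u v : V} (h : T.Adj u v) :
    T.Adj (levelMap hT o o' σ (T.dist u o) u) (levelMap hT o o' σ (T.dist v o) v) := by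
  wlog hd : T.dist u o + 1 = T.dist v o generalizing u v
  · refine (this h.symm ?_).symm
    have := hT.dist_adj_cases h o
    omega
  have hu := hT.eq_toward h.symm hd
  obtain ⟨h1, h2, h3⟩ := levelMap_spec hT c ho hσ _ u rfl
  rw [← hd]
  change T.Adj _ (σ (hT.toward v o) (levelMap hT o o' σ (T.dist u o) (hT.toward v o)) v)
  rw [← hu]
  exact (hσ _ _ v h1.symm h2.symm h hd.symm).1

/-- The automorphism assembled from child maps. -/
noncomputable def levelIso (hT : T.IsTree) (c : T.Coloring Bool) {o o' : V}
    {σ τ : V → V → V → V} (ho : c o = c o') (hσ : IsChildMap c o o' σ τ)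
    (hτ : IsChildMap c o' o τ σ) : T ≃g T where
  toFun v := levelMap hT o o' σ (T.dist v o) v
  invFun v := levelMap hT o' o τ (T.dist v o') v
  left_inv v := by
    obtain ⟨h1, h2, h3⟩ := levelMap_spec hT c ho hσ _ v rfl
    simp only [h1, h3]
  right_inv v := by
    obtain ⟨h1, h2, h3⟩ := levelMap_spec hT c ho.symm hτ _ v rfl
    simp only [h1, h3]
  map_rel_iff' {u v} := by
    refine ⟨fun h => ?_, fun h => levelMap_adj hT c ho hσ h⟩
    have := levelMap_adj hT c ho.symm hτ h
    simp only [Equiv.coe_fn_mk] at this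
    obtain ⟨h1, h2, h3⟩ := levelMap_spec hT c ho hσ _ u rfl
    obtain ⟨k1, k2, k3⟩ := levelMap_spec hT c ho hσ _ v rfl
    rwa [h1, h3, k1, k3] at this

/-- Any bijection is corrected by the transposition of its value at `a` with `b`. Prescribing one
value is what lets an automorphism follow a given geodesic. -/
theorem exists_inverse_maps {A B : Set V} (hA : A.Finite) (h : A.encard = B.encard) (a b : V) :
    ∃ s t : V → V, (∀ v ∈ A, s v ∈ B ∧ t (s v) = v) ∧ (∀ w ∈ B, t w ∈ A ∧ s (t w) = w) ∧
      (a ∈ A → b ∈ B → s a = b) := by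
  classical
  have : Nonempty V := ⟨a⟩
  obtain ⟨f, hf⟩ := hA.exists_bijOn_of_encard_eq h
  by_cases hab : a ∈ A ∧ b ∈ B
  · obtain ⟨ha, hb⟩ := hab
    have hbij : Set.BijOn (Equiv.swap (f a) b ∘ f) A B := by
      refine Set.BijOn.comp (t := B) ?_ hf
      refine ⟨fun x hx => ?_, (Equiv.swap (f a) b).injective.injOn, fun x hx => ?_⟩
      · rw [Equiv.swap_apply_def]
        split_ifs
        exacts [hb, hf.mapsTo ha, hx]
      · refine ⟨Equiv.swap (f a) b x, ?_, Equiv.swap_apply_self _ _ _⟩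
        rw [Equiv.swap_apply_def]
        split_ifs
        exacts [hb, hf.mapsTo ha, hx]
    have hinv := hbij.invOn_invFunOn
    refine ⟨_, Function.invFunOn (Equiv.swap (f a) b ∘ f) A,
      fun v hv => ⟨hbij.mapsTo hv, hinv.1 hv⟩,
      fun w hw => ⟨(hbij.symm hinv.symm).mapsTo hw, hinv.2 hw⟩, fun _ _ => by simp⟩
  · have hinv := hf.invOn_invFunOn
    exact ⟨f, Function.invFunOn f A, fun v hv => ⟨hf.mapsTo hv, hinv.1 hv⟩,
      fun w hw => ⟨(hf.symm hinv.symm).mapsTo hw, hinv.2 hw⟩, fun h1 h2 => absurd ⟨h1, h2⟩ hab⟩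

theorem encard_children (hT : T.IsTree) (a o : V) :
    {v | T.Adj a v ∧ T.dist v o = T.dist a o + 1}.encard + (if T.dist a o = 0 then 0 else 1)
      = (T.neighborSet a).encard := by
  by_cases h : a = o
  · subst h
    rw [if_pos (by simp), add_zero]
    congr 1
    ext v
    simp only [Set.mem_ofPred_eq, SimpleGraph.mem_neighborSet, SimpleGraph.dist_self]
    exact ⟨fun h => h.1, fun h => ⟨h, SimpleGraph.dist_eq_one_iff_adj.2 h.symm⟩⟩
  · rw [if_neg (by rwa [hT.connected.dist_eq_zero_iff]),
      ← Set.encard_sdiff_singleton_add_one (s := T.neighborSet a) (a := hT.toward a o) (hT.adj_toward h)]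
    congr 2
    ext v
    simp only [Set.mem_ofPred_eq, Set.mem_sdiff, SimpleGraph.mem_neighborSet,
      Set.mem_singleton_iff]
    constructor
    · rintro ⟨h1, h2⟩
      refine ⟨h1, ?_⟩
      rintro rfl
      have := hT.dist_toward h
      omega
    · rintro ⟨h1, h2⟩
      exact ⟨h1, hT.dist_adj_of_ne_toward h1 h2⟩

/-- The group of automorphisms of a biregular tree acts transitively on the pairs of vertices with
given distance and given colours. -/
theorem exists_treeAut_smul_eq (hT : T.IsTree) (c : T.Coloring Bool) {d : Bool → ℕ}
    (hd : ∀ v, (T.neighborSet v).encard = d (c v)) {o o' x x' : V} (ho : c o = c o')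
    (hx : T.dist x o = T.dist x' o') : ∃ g : TreeAut T, g • o = o' ∧ g • x = x' := by
  classical
  -- `A r a` is the set of children of `a` in the tree rooted at `r`. The child map is chosen to
  -- send the child towards `x` to the child towards `x'`, so that the geodesic from `o` to `x` is
  -- carried to the one from `o'` to `x'`.
  let A : V → V → Set V := fun r a => {v | T.Adj a v ∧ T.dist v r = T.dist a r + 1}
  have key : ∀ a b, ∃ s t : V → V, T.dist a o = T.dist b o' → c a = c b →
      (∀ v ∈ A o a, s v ∈ A o' b ∧ t (s v) = v) ∧ (∀ w ∈ A o' b, t w ∈ A o a ∧ s (t w) = w) ∧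
      (hT.toward a x ∈ A o a → hT.toward b x' ∈ A o' b →
        s (hT.toward a x) = hT.toward b x') := by
    intro a b
    by_cases h : T.dist a o = T.dist b o' ∧ c a = c b
    · have hfin : (A o a).Finite := by
        refine Set.Finite.subset (s := T.neighborSet a) ?_ fun v hv => hv.1
        exact Set.finite_of_encard_eq_coe (hd a)
      have hcard : (A o a).encard = (A o' b).encard := by
        have h1 : (A o a).encard + _ = _ := encard_children hT a o
        have h2 : (A o' b).encard + _ = _ := encard_children hT b o'
        rw [hd, h.2, ← hd, ← h2, h.1] at h1
        split_ifs at h1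
        · simpa using h1
        · exact ENat.add_left_injective_of_ne_top (n := 1) (by simp) h1
      obtain ⟨s, t, hst⟩ := exists_inverse_maps hfin hcard (hT.toward a x) (hT.toward b x')
      exact ⟨s, t, fun _ _ => hst⟩
    · exact ⟨id, id, fun h1 h2 => absurd ⟨h1, h2⟩ h⟩
  choose σ τ hστ using key
  have hσ : IsChildMap c o o' σ (fun b a => τ a b) := by
    intro a b v h1 h2 h3 h4
    obtain ⟨h, h'⟩ := (hστ a b h1 h2).1 v ⟨h3, h4⟩
    exact ⟨h.1, h.2, h'⟩
  have hτ : IsChildMap c o' o (fun b a => τ a b) σ := by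
    intro b a v h1 h2 h3 h4
    obtain ⟨h, h'⟩ := (hστ a b h1.symm h2.symm).2.1 v ⟨h3, h4⟩
    exact ⟨h.1, h.2, h'⟩
  let g := levelIso hT c ho hσ hτ
  have hgc : ∀ v, c (g v) = c v := fun v => (levelMap_spec hT c ho hσ _ v rfl).2.1
  have hgmem : g ∈ evenAut T := by
    intro v
    obtain ⟨p⟩ := hT.connected (g v) v
    exact ⟨p, (c.even_length_iff_congr p).2 (by rw [hgc])⟩
  -- The equality of distances says that `v` lies on the geodesic from `o` to `x`, and likewise for
  -- `v'`.
  have hgeo : ∀ n v v', T.dist v o = n → T.dist v' o' = n → T.dist v o + T.dist v x = T.dist x o →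
      T.dist v' o' + T.dist v' x' = T.dist x' o' → g v = v' := by
    intro n
    induction n with
    | zero =>
      intro v v' h1 h2 _ _
      rw [hT.connected.dist_eq_zero_iff] at h2
      change levelMap hT o o' σ (T.dist v o) v = v'
      rw [h1, h2]
      rfl
    | succ n ih =>
      have aux : ∀ r y v : V, T.dist v r = n + 1 → T.dist v r + T.dist v y = T.dist y r →
          T.dist (hT.toward v r) r = n ∧
          T.dist (hT.toward v r) r + T.dist (hT.toward v r) y = T.dist y r ∧
          v = hT.toward (hT.toward v r) y ∧ v ∈ A r (hT.toward v r) := by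
        intro r y v h1 h2
        have hvr : v ≠ r := by rintro rfl; simp at h1
        have hadj := hT.adj_toward hvr
        have hdr := hT.dist_toward hvr
        have htri := hT.connected.dist_triangle (u := y) (v := hT.toward v r) (w := r)
        rw [SimpleGraph.dist_comm (u := y) (v := hT.toward v r)] at htri
        have := hT.dist_adj_cases hadj y
        have h3 : T.dist v y + 1 = T.dist (hT.toward v r) y := by omega
        exact ⟨by omega, by omega, hT.eq_toward hadj.symm h3, hadj.symm, by omega⟩
      intro v v' h1 h2 h3 h4
      obtain ⟨a1, a2, a3, a4⟩ := aux o x v h1 h3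
      obtain ⟨b1, b2, b3, b4⟩ := aux o' x' v' h2 h4
      have hu := ih _ _ a1 b1 a2 b2
      have hcu : c (hT.toward v o) = c (hT.toward v' o') := by rw [← hu, hgc]
      have hfin := (hστ (hT.toward v o) (hT.toward v' o') (by rw [a1, b1]) hcu).2.2
        (by rw [← a3]; exact a4) (by rw [← b3]; exact b4)
      rw [← a3, ← b3] at hfin
      change levelMap hT o o' σ (T.dist v o) v = v'
      rw [h1]
      change σ (hT.toward v o) (levelMap hT o o' σ n (hT.toward v o)) v = v'
      change levelMap hT o o' σ (T.dist (hT.toward v o) o) (hT.toward v o) = _ at hu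
      rw [a1] at hu
      rw [hu, hfin]
  refine ⟨⟨g, hgmem⟩, ?_, ?_⟩
  · exact hgeo 0 o o' (by simp) (by simp) (by simp [SimpleGraph.dist_comm])
      (by simp [SimpleGraph.dist_comm])
  · exact hgeo _ x x' rfl hx.symm (by simp) (by simp)

end Extension

/-! ### Reversible bipartite kernels -/

/-- A summable measure `μ` on a countable set together with a bipartite, biregular kernel `n` that
is reversible with respect to `μ`. -/
structure BipartiteKernel (ι : Type*) where
  /-- the measure -/
  μ : ι → ℝ
  /-- the kernel -/
  n : ι → ι → ℝ
  /-- the colour classes -/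
  col : ι → Bool
  /-- the row sum of the first colour, minus one -/
  p : ℝ
  /-- the row sum of the second colour, minus one -/
  q : ℝ
  μ_pos : ∀ a, 0 < μ a
  μ_summable : Summable μ
  n_nonneg : ∀ a b, 0 ≤ n a b
  n_finite : ∀ a, (Function.support (n a)).Finite
  row_sum : ∀ a, ∑' b, n a b = bif col a then p + 1 else q + 1
  balance : ∀ a b, μ a * n a b = μ b * n b a
  col_ne : ∀ a b, n a b ≠ 0 → col a ≠ col b
  two_le_p : 2 ≤ p
  two_le_q : 2 ≤ q

/-- The algebra of bounded real functions. -/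
def boundedFunctions (ι : Type*) : Subalgebra ℝ (ι → ℝ) where
  carrier := {f | ∃ C, ∀ a, |f a| ≤ C}
  mul_mem' := by
    rintro f g ⟨C, hC⟩ ⟨D, hD⟩
    refine ⟨C * D, fun a => ?_⟩
    rw [Pi.mul_apply, abs_mul]
    exact mul_le_mul (hC a) (hD a) (abs_nonneg _) ((abs_nonneg _).trans (hC a))
  add_mem' := by
    rintro f g ⟨C, hC⟩ ⟨D, hD⟩
    exact ⟨C + D, fun a => (abs_add_le _ _).trans (add_le_add (hC a) (hD a))⟩
  algebraMap_mem' r := ⟨|r|, fun _ => le_rfl⟩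

namespace BipartiteKernel

variable {ι : Type*} (K : BipartiteKernel ι)

/-- The algebra of bounded functions, which carries the inner product of `L²(μ)`. -/
def Fun (_K : BipartiteKernel ι) : Type _ := boundedFunctions ι

noncomputable instance : CommRing K.Fun := inferInstanceAs (CommRing (boundedFunctions ι))

noncomputable instance : Algebra ℝ K.Fun := inferInstanceAs (Algebra ℝ (boundedFunctions ι))

/-- The function underlying an element of `K.Fun`. -/
def Fun.val {K : BipartiteKernel ι} (f : K.Fun) : ι → ℝ := Subtype.val (p := (· ∈ boundedFunctions ι)) f

instance : CoeFun K.Fun fun _ => ι → ℝ := ⟨Fun.val⟩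

/-- A bounded function as an element of `K.Fun`. -/
def mkFun (f : ι → ℝ) (C : ℝ) (h : ∀ a, |f a| ≤ C) : K.Fun :=
  (⟨f, C, h⟩ : boundedFunctions ι)

variable {K}

theorem Fun.bounded (f : K.Fun) : ∃ C, ∀ a, |f a| ≤ C :=
  Subtype.property (p := (· ∈ boundedFunctions ι)) f

@[simp] theorem mkFun_apply (f : ι → ℝ) (C : ℝ) (h : ∀ a, |f a| ≤ C) (a : ι) :
    K.mkFun f C h a = f a := rfl

@[ext] theorem Fun.ext {f g : K.Fun} (h : ∀ a, f a = g a) : f = g := Subtype.ext (funext h)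

@[simp] theorem add_apply (f g : K.Fun) (a : ι) : (f + g) a = f a + g a := rfl
@[simp] theorem sub_apply (f g : K.Fun) (a : ι) : (f - g) a = f a - g a := rfl
@[simp] theorem mul_apply (f g : K.Fun) (a : ι) : (f * g) a = f a * g a := rfl
@[simp] theorem smul_apply (r : ℝ) (f : K.Fun) (a : ι) : (r • f) a = r * f a := rfl
@[simp] theorem one_apply (a : ι) : (1 : K.Fun) a = 1 := rfl

theorem summable_mul (f : K.Fun) : Summable fun a => K.μ a * f a := by
  obtain ⟨C, hC⟩ := f.bounded
  refine Summable.of_norm_bounded (K.μ_summable.mul_left C) fun a => ?_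
  rw [norm_mul, Real.norm_eq_abs, abs_of_pos (K.μ_pos a), mul_comm]
  exact mul_le_mul_of_nonneg_right (hC a) (K.μ_pos a).le

variable (K) in
/-- Integration with respect to `μ`. -/
noncomputable def int : K.Fun →ₗ[ℝ] ℝ where
  toFun f := ∑' a, K.μ a * f a
  map_add' f g := by
    rw [← (summable_mul f).tsum_add (summable_mul g)]
    simp [mul_add]
  map_smul' r f := by
    rw [RingHom.id_apply, smul_eq_mul, ← tsum_mul_left]
    refine tsum_congr fun a => ?_
    rw [smul_apply]
    ring

theorem int_apply (f : K.Fun) : K.int f = ∑' a, K.μ a * f a := rfl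

theorem int_nonneg {f : K.Fun} (h : ∀ a, 0 ≤ f a) : 0 ≤ K.int f :=
  tsum_nonneg fun a => mul_nonneg (K.μ_pos a).le (h a)

theorem int_mono {f g : K.Fun} (h : ∀ a, f a ≤ g a) : K.int f ≤ K.int g :=
  (summable_mul f).tsum_le_tsum (fun a => mul_le_mul_of_nonneg_left (h a) (K.μ_pos a).le)
    (summable_mul g)

theorem mul_le_int {f : K.Fun} (h : ∀ a, 0 ≤ f a) (a : ι) : K.μ a * f a ≤ K.int f :=
  (summable_mul f).le_tsum a fun b _ => mul_nonneg (K.μ_pos b).le (h b)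

theorem summable_row (a : ι) (f : ι → ℝ) : Summable fun b => K.n a b * f b :=
  summable_of_hasFiniteSupport ((K.n_finite a).subset fun b hb => by
    rw [Function.mem_support] at hb ⊢
    exact left_ne_zero_of_mul hb)

theorem summable_n (a : ι) : Summable (K.n a) := summable_of_hasFiniteSupport (K.n_finite a)

theorem row_sum_le (a : ι) : ∑' b, K.n a b ≤ K.p + K.q := by
  have := K.two_le_p
  have := K.two_le_q
  rw [K.row_sum]
  cases K.col a <;> simp <;> linarith

variable (K) in
/-- The operator given by the kernel. -/
noncomputable def op : K.Fun →ₗ[ℝ] K.Fun where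
  toFun f := K.mkFun (fun a => ∑' b, K.n a b * f b) ((K.p + K.q) * |f.bounded.choose|) fun a => by
    have hC := f.bounded.choose_spec
    set C := f.bounded.choose
    rw [← Real.norm_eq_abs]
    refine (tsum_of_norm_bounded ((summable_n (K := K) a).mul_right |C|).hasSum
      fun b => ?_).trans ?_
    · rw [norm_mul, Real.norm_eq_abs, abs_of_nonneg (K.n_nonneg a b)]
      exact mul_le_mul_of_nonneg_left ((hC b).trans (le_abs_self C)) (K.n_nonneg a b)
    · rw [tsum_mul_right]
      exact mul_le_mul_of_nonneg_right (row_sum_le a) (abs_nonneg C)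
  map_add' f g := by
    refine Fun.ext fun a => ?_
    change ∑' b, K.n a b * (f b + g b) = ∑' b, K.n a b * f b + ∑' b, K.n a b * g b
    rw [← (summable_row a f).tsum_add (summable_row a g)]
    simp [mul_add]
  map_smul' r f := by
    refine Fun.ext fun a => ?_
    change ∑' b, K.n a b * (r * f b) = r * ∑' b, K.n a b * f b
    rw [← tsum_mul_left]
    exact tsum_congr fun b => by ring

theorem op_apply (f : K.Fun) (a : ι) : K.op f a = ∑' b, K.n a b * f b := rfl

/-- Fubini and the balance condition. Absolute convergence holds because the row sums and both
functions are bounded and `μ` is summable. -/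
theorem int_op_mul (f g : K.Fun) : K.int (K.op f * g) = K.int (f * K.op g) := by
  obtain ⟨C, hC⟩ := f.bounded
  obtain ⟨D, hD⟩ := g.bounded
  have hs : Summable fun x : ι × ι => K.μ x.1 * K.n x.1 x.2 := by
    have h0 : ∀ x : ι × ι, 0 ≤ K.μ x.1 * K.n x.1 x.2 :=
      fun x => mul_nonneg (K.μ_pos x.1).le (K.n_nonneg x.1 x.2)
    rw [summable_prod_of_nonneg h0]
    refine ⟨fun a => (summable_n a).mul_left (K.μ a), ?_⟩
    simp only [tsum_mul_left]
    refine Summable.of_nonneg_of_le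
      (fun a => mul_nonneg (K.μ_pos a).le (tsum_nonneg (K.n_nonneg a)))
      (fun a => mul_le_mul_of_nonneg_left (row_sum_le a) (K.μ_pos a).le)
      (K.μ_summable.mul_right _)
  have hs' : Summable fun x : ι × ι => K.μ x.1 * K.n x.1 x.2 * (f x.2 * g x.1) := by
    refine Summable.of_norm_bounded (hs.mul_right (C * D)) fun x => ?_
    rw [norm_mul, Real.norm_eq_abs,
      abs_of_nonneg (mul_nonneg (K.μ_pos x.1).le (K.n_nonneg x.1 x.2)), Real.norm_eq_abs, abs_mul]
    exact mul_le_mul_of_nonneg_left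
      (mul_le_mul (hC _) (hD _) (abs_nonneg _) ((abs_nonneg _).trans (hC x.2)))
      (mul_nonneg (K.μ_pos x.1).le (K.n_nonneg x.1 x.2))
  have h1 : K.int (K.op f * g) = ∑' a, ∑' b, K.μ a * K.n a b * (f b * g a) := by
    refine tsum_congr fun a => ?_
    rw [mul_apply, op_apply, ← tsum_mul_right, ← tsum_mul_left]
    exact tsum_congr fun b => by ring
  have h2 : K.int (f * K.op g) = ∑' b, ∑' a, K.μ a * K.n a b * (f b * g a) := by
    refine tsum_congr fun b => ?_
    rw [mul_apply, op_apply, ← tsum_mul_left, ← tsum_mul_left]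
    refine tsum_congr fun a => ?_
    rw [K.balance a b]
    ring
  rw [h1, h2]
  exact (Summable.tsum_comm (f := fun a b => K.μ a * K.n a b * (f b * g a)) hs').symm

variable (K) in
/-- The row sums of the kernel. -/
noncomputable def deg : K.Fun := K.op 1

theorem deg_apply (a : ι) : (K.deg : K.Fun) a = bif K.col a then K.p + 1 else K.q + 1 := by
  rw [deg, op_apply, ← K.row_sum]
  simp

theorem op_eq_zero {f : K.Fun} {i : Bool} (h : ∀ a, K.col a = i → f a = 0) {a : ι}
    (ha : K.col a = !i) : K.op f a = 0 := by
  rw [op_apply]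
  refine (tsum_congr fun b => ?_).trans tsum_zero
  by_cases hn : K.n a b = 0
  · rw [hn, zero_mul]
  · rw [h b, mul_zero]
    have := K.col_ne a b hn
    rw [ha] at this
    cases i <;> cases h : K.col b <;> simp_all

/-! #### The inner product -/

variable (K) in
/-- The inner product of `L²(μ)` on bounded functions. -/
@[reducible] noncomputable def core : InnerProductSpace.Core ℝ K.Fun where
  inner f g := K.int (f * g)
  conj_inner_symm f g := by rw [mul_comm]; rfl
  re_inner_nonneg f := int_nonneg fun a => mul_self_nonneg (f a)
  add_left f g h := by rw [add_mul, map_add]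
  smul_left f g r := by rw [smul_mul_assoc, map_smul]; rfl
  definite f hf := by
    refine Fun.ext fun a => ?_
    have h1 := mul_le_int (f := f * f) (fun a => mul_self_nonneg (f a)) a
    change K.int (f * f) = 0 at hf
    rw [hf, mul_apply] at h1
    have h2 := K.μ_pos a
    have h3 : f a * f a ≤ 0 := by
      by_contra! h
      exact absurd h1 (not_le.2 (mul_pos h2 h))
    exact mul_self_eq_zero.1 (le_antisymm h3 (mul_self_nonneg _))

noncomputable instance : NormedAddCommGroup K.Fun := K.core.toNormedAddCommGroup

noncomputable instance : InnerProductSpace ℝ K.Fun := InnerProductSpace.ofCore K.core.toCore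

theorem inner_eq (f g : K.Fun) : inner ℝ f g = K.int (f * g) := rfl

theorem norm_sq_eq (f : K.Fun) : ‖f‖ ^ 2 = K.int (f * f) := by
  rw [← real_inner_self_eq_norm_sq, inner_eq]

/-! #### The Dirichlet form and the spectral gap -/

/-- The gradient squared, `∑ b, n a b (f b - f a) ^ 2`. -/
noncomputable def grad (f : K.Fun) : K.Fun := K.op (f * f) - (2 : ℝ) • (f * K.op f) + K.deg * (f * f)

theorem grad_apply (f : K.Fun) (a : ι) : grad f a = ∑' b, K.n a b * (f b - f a) ^ 2 := by
  have h : ∀ b, K.n a b * (f b - f a) ^ 2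
      = (K.n a b * (f * f) b - 2 * f a * (K.n a b * f b)) + f a * f a * (K.n a b * (1 : K.Fun) b) := by
    intro b
    rw [mul_apply, one_apply]
    ring
  rw [tsum_congr h, Summable.tsum_add, Summable.tsum_sub, tsum_mul_left, tsum_mul_left,
    ← op_apply, ← op_apply, ← op_apply]
  · change K.op (f * f) a - 2 * (f a * K.op f a) + K.op 1 a * (f a * f a) = _
    ring
  · exact summable_row a _
  · exact (summable_row a f).mul_left _
  · exact (summable_row a _).sub ((summable_row a f).mul_left _)
  · exact (summable_row a _).mul_left _

theorem grad_nonneg (f : K.Fun) (a : ι) : 0 ≤ grad f a := by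
  rw [grad_apply]
  exact tsum_nonneg fun b => mul_nonneg (K.n_nonneg a b) (sq_nonneg _)

theorem mul_sq_le_grad (f : K.Fun) (a b : ι) : K.n a b * (f b - f a) ^ 2 ≤ grad f a := by
  rw [grad_apply]
  exact (summable_row a fun b => (f b - f a) ^ 2).le_tsum b fun c _ =>
    mul_nonneg (K.n_nonneg a c) (sq_nonneg _)

/-- By symmetry the integral of `K.op (f * f)` equals that of `K.deg * (f * f)`, so two of the three
terms of the gradient coincide. -/
theorem int_grad (f : K.Fun) :
    K.int (grad f) = 2 * K.int (K.deg * (f * f)) - 2 * K.int (f * K.op f) := by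
  have h := int_op_mul (f * f) (1 : K.Fun)
  rw [mul_one, mul_comm (f * f)] at h
  rw [grad, map_add, map_sub, map_smul, h, smul_eq_mul, deg]
  ring

variable (K) in
/-- The Poincaré inequality. -/
def Poincare : Prop :=
  ∃ x₀ : ι, ∃ C : ℝ, 0 < C ∧ ∀ f : K.Fun,
    K.int ((f - f x₀ • (1 : K.Fun)) * (f - f x₀ • (1 : K.Fun))) ≤ C * K.int (grad f)

variable (K) in
/-- The functions of mean zero that are supported on the first colour class. -/
noncomputable def evenMeanZero : Submodule ℝ K.Fun where
  carrier := {f | (∀ a, K.col a = false → f a = 0) ∧ K.int f = 0}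
  add_mem' := by
    rintro f g ⟨h1, h2⟩ ⟨h3, h4⟩
    refine ⟨fun a ha => ?_, by rw [map_add, h2, h4, add_zero]⟩
    rw [add_apply, h1 a ha, h3 a ha, add_zero]
  zero_mem' := ⟨fun _ _ => rfl, map_zero _⟩
  smul_mem' := by
    rintro r f ⟨h1, h2⟩
    refine ⟨fun a ha => ?_, by rw [map_smul, h2, smul_zero]⟩
    rw [smul_apply, h1 a ha, mul_zero]

theorem int_deg_mul_of_even {f : K.Fun} (h : ∀ a, K.col a = false → f a = 0) :
    K.int (K.deg * f) = (K.p + 1) * K.int f := by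
  rw [← smul_eq_mul (K.p + 1), ← map_smul]
  congr 1
  ext a
  rw [mul_apply, smul_apply, deg_apply]
  cases ha : K.col a
  · rw [h a ha, mul_zero, mul_zero]
  · rfl

theorem int_deg_mul_of_odd {f : K.Fun} (h : ∀ a, K.col a = true → f a = 0) :
    K.int (K.deg * f) = (K.q + 1) * K.int f := by
  rw [← smul_eq_mul (K.q + 1), ← map_smul]
  congr 1
  ext a
  rw [mul_apply, smul_apply, deg_apply]
  cases ha : K.col a
  · rfl
  · rw [h a ha, mul_zero, mul_zero]

theorem op_odd {f : K.Fun} (h : ∀ a, K.col a = false → f a = 0) (a : ι)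
    (ha : K.col a = true) : K.op f a = 0 := op_eq_zero (i := false) h ha

theorem op_even {f : K.Fun} (h : ∀ a, K.col a = true → f a = 0) (a : ι)
    (ha : K.col a = false) : K.op f a = 0 := op_eq_zero (i := true) h ha

theorem op_op_mem {f : K.Fun} (hf : f ∈ K.evenMeanZero) : K.op (K.op f) ∈ K.evenMeanZero := by
  obtain ⟨h1, h2⟩ := hf
  refine ⟨op_even (op_odd h1), ?_⟩
  rw [← mul_one (K.op (K.op f)), int_op_mul, mul_comm]
  change K.int (K.deg * _) = 0
  rw [int_deg_mul_of_odd (op_odd h1), ← mul_one (K.op f), int_op_mul, mul_comm f]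
  change _ * K.int (K.deg * _) = 0
  rw [int_deg_mul_of_even h1, h2]
  ring

/-- The function φ alone is a useless test function, as its Dirichlet form does not see Aφ. The test
function is φ + cAφ, whose two parts live on different colour classes. Its gradient integrates to
2(p+1)‖φ‖² + (2(q+1)c² - 4c)‖Aφ‖². The choice c = 1/(q+1) minimises the bracket and makes it -2c, so
the Poincaré inequality becomes an upper bound for ‖Aφ‖². -/
theorem spectral_gap (hP : K.Poincare) : ∃ ε : ℝ, 0 < ε ∧ ∀ φ ∈ K.evenMeanZero,
    K.int (K.op φ * K.op φ) ≤ ((K.p + 1) * (K.q + 1) - ε) * K.int (φ * φ) := by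
  obtain ⟨x₀, C, hC, h⟩ := hP
  have hq := K.two_le_q
  refine ⟨(K.q + 1) / (2 * C), by positivity, ?_⟩
  rintro φ ⟨h1, h2⟩
  have hA := op_odd h1
  set ψ := K.op φ with hψ
  set c := (K.q + 1)⁻¹ with hc
  have hqc : (K.q + 1) * c = 1 := mul_inv_cancel₀ (by linarith)
  have key := h (φ + c • ψ)
  set t := (φ + c • ψ) x₀
  -- The contribution of the second class is dropped. On the first class (φ - t)² ≥ φ² - 2tφ, and
  -- the linear term integrates to zero.
  have hlow : K.int (φ * φ) ≤
      K.int ((φ + c • ψ - t • (1 : K.Fun)) * (φ + c • ψ - t • (1 : K.Fun))) := by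
    have : K.int (φ * φ - (2 * t) • φ) = K.int (φ * φ) := by
      rw [map_sub, map_smul, h2, smul_zero, sub_zero]
    rw [← this]
    refine int_mono fun a => ?_
    simp only [sub_apply, mul_apply, smul_apply, add_apply, one_apply]
    cases ha : K.col a
    · rw [h1 a ha]
      nlinarith [sq_nonneg (c * ψ a - t)]
    · rw [hA a ha]
      nlinarith [sq_nonneg t]
  have hdeg : K.int (K.deg * ((φ + c • ψ) * (φ + c • ψ)))
      = (K.p + 1) * K.int (φ * φ) + c * K.int (ψ * ψ) := by
    have e : (φ + c • ψ) * (φ + c • ψ) = φ * φ + (c * c) • (ψ * ψ) := by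
      ext a
      simp only [mul_apply, smul_apply, add_apply]
      cases ha : K.col a
      · rw [h1 a ha]; ring
      · rw [hA a ha]; ring
    rw [e, mul_add, map_add, int_deg_mul_of_even, mul_smul_comm, map_smul, int_deg_mul_of_odd,
      smul_eq_mul]
    · linear_combination c * K.int (ψ * ψ) * hqc
    · intro a ha
      rw [mul_apply, hA a ha, zero_mul]
    · intro a ha
      rw [mul_apply, h1 a ha, zero_mul]
  have hcross : K.int ((φ + c • ψ) * K.op (φ + c • ψ)) = 2 * c * K.int (ψ * ψ) := by
    have e : (φ + c • ψ) * K.op (φ + c • ψ) = c • (φ * K.op ψ) + c • (ψ * ψ) := by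
      ext a
      rw [map_add, map_smul]
      simp only [mul_apply, smul_apply, add_apply]
      cases ha : K.col a
      · rw [h1 a ha, op_even hA a ha]
        ring
      · rw [hA a ha]
        ring
    rw [e, map_add, map_smul, map_smul, ← int_op_mul, smul_eq_mul]
    ring
  rw [int_grad, hdeg, hcross] at key
  have := hlow.trans key
  have e : (K.q + 1) / (2 * C) * (C * (2 * ((K.p + 1) * K.int (φ * φ) + c * K.int (ψ * ψ)) -
      2 * (2 * c * K.int (ψ * ψ)))) =
      (K.p + 1) * (K.q + 1) * K.int (φ * φ) - K.int (ψ * ψ) := by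
    field_simp
    linear_combination (-K.int (ψ * ψ)) * hqc
  have h3 := mul_le_mul_of_nonneg_left this (show 0 ≤ (K.q + 1) / (2 * C) by positivity)
  rw [e] at h3
  linarith

/-! #### Decay of the sphere operators -/

variable (K) in
/-- The operators that sum a function over the spheres of even radius around the vertices of the
first colour class. -/
noncomputable def sphereOp : ℕ → K.Fun →ₗ[ℝ] K.Fun
  | 0 => LinearMap.id
  | 1 => K.op ∘ₗ K.op - (K.p + 1) • LinearMap.id
  | 2 => (K.op ∘ₗ K.op - (K.p + K.q) • LinearMap.id) ∘ₗ sphereOp 1 -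
      (K.q * (K.p + 1)) • LinearMap.id
  | k + 3 => (K.op ∘ₗ K.op - (K.p + K.q) • LinearMap.id) ∘ₗ sphereOp (k + 2) -
      (K.p * K.q) • sphereOp (k + 1)

theorem sphereOp_mem {f : K.Fun} (hf : f ∈ K.evenMeanZero) : ∀ k, K.sphereOp k f ∈ K.evenMeanZero
  | 0 => hf
  | 1 => K.evenMeanZero.sub_mem (op_op_mem hf) (K.evenMeanZero.smul_mem _ hf)
  | 2 => K.evenMeanZero.sub_mem (K.evenMeanZero.sub_mem (op_op_mem (sphereOp_mem hf 1))
      (K.evenMeanZero.smul_mem _ (sphereOp_mem hf 1))) (K.evenMeanZero.smul_mem _ hf)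
  | k + 3 => K.evenMeanZero.sub_mem (K.evenMeanZero.sub_mem (op_op_mem (sphereOp_mem hf (k + 2)))
      (K.evenMeanZero.smul_mem _ (sphereOp_mem hf (k + 2))))
      (K.evenMeanZero.smul_mem _ (sphereOp_mem hf (k + 1)))

/-- An eigenvalue τ of a compression of A² to functions of mean zero satisfies 0 ≤ τ ≤ (p+1)(q+1) -
ε, so the sphere operators obey the scalar recurrence with coefficient τ - (p+q) in the range of
`norm_root_le`. The rate is below pq since p, q ≥ 2 gives max(p, q) < pq. -/
theorem abs_int_sphereOp_mul_le (hP : K.Poincare) : ∃ r C : ℝ, 0 < r ∧ r < K.p * K.q ∧ 0 ≤ C ∧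
    ∀ φ ∈ K.evenMeanZero, ∀ k : ℕ,
      |K.int (K.sphereOp k φ * φ)| ≤ C * (k + 1) * r ^ k * K.int (φ * φ) := by
  obtain ⟨ε, hε, hgap⟩ := spectral_gap hP
  have hp := K.two_le_p
  have hq := K.two_le_q
  set r := max (max K.p K.q) (K.p * K.q - ε) with hr
  set b := (K.p + 1) * (K.q + 1) - ε with hb
  have hr2 : 2 ≤ r := (hp.trans (le_max_left _ _)).trans (le_max_left _ _)
  refine ⟨r, |(K.p + 1) / K.p| + (|b| + |K.p + 1|), by linarith, ?_, by positivity, ?_⟩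
  · refine max_lt (max_lt ?_ ?_) ?_
    · nlinarith
    · nlinarith
    · linarith
  intro φ hφ k
  have hpos : ∀ f : K.Fun, 0 ≤ K.int (f * f) := fun f => int_nonneg fun a => mul_self_nonneg (f a)
  cases k with
  | zero =>
    have h1 : 1 ≤ |(K.p + 1) / K.p| := by
      refine le_trans ?_ (le_abs_self _)
      rw [le_div_iff₀ (by linarith)]
      linarith
    have h2 := abs_nonneg b
    have h3 := abs_nonneg (K.p + 1)
    change |K.int (φ * φ)| ≤ _
    rw [abs_of_nonneg (hpos φ)]
    simp only [Nat.cast_zero, zero_add, mul_one, pow_zero]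
    exact le_mul_of_one_le_left (hpos φ) (by linarith)
  | succ k =>
    -- Rescaling the initial term by (p+1)/p makes the recurrence uniform: the exceptional
    -- coefficient q(p+1) of the step to k = 2 is pq · (p+1)/p.
    let x : ℕ → K.Fun := fun j => if j = 0 then ((K.p + 1) / K.p) • φ else K.sphereOp j φ
    have hsym : (K.op ∘ₗ K.op).IsSymmetric := by
      intro f g
      change K.int (K.op (K.op f) * g) = K.int (f * K.op (K.op g))
      rw [int_op_mul, int_op_mul]
    have main := abs_inner_le_of_operator_recurrence (K.op ∘ₗ K.op) hsym K.evenMeanZero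
      (b := b) ?_ φ x hφ ?_ (K.p + K.q) (K.p * K.q) ((K.p + 1) / K.p) (K.p + 1) rfl rfl ?_
      (fun j => (j + 1) * r ^ j) ?_ ?_ (k + 1)
    · rw [inner_eq, norm_sq_eq] at main
      change |K.int (K.sphereOp (k + 1) φ * φ)| ≤ _ at main
      refine main.trans (mul_le_mul_of_nonneg_right ?_ (hpos φ))
      rw [mul_comm, mul_assoc, ← mul_assoc]
      rw [mul_assoc]
      exact mul_le_mul_of_nonneg_right
        (add_le_add le_rfl (add_le_add (le_abs_self b) le_rfl)) (by positivity)
    · intro f hf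
      rw [inner_eq, norm_sq_eq, LinearMap.comp_apply, int_op_mul]
      exact ⟨hpos _, hgap f hf⟩
    · intro j
      by_cases hj : j = 0
      · simp only [x, if_pos hj]
        exact K.evenMeanZero.smul_mem _ hφ
      · simp only [x, if_neg hj]
        exact sphereOp_mem hφ j
    · intro j
      cases j with
      | zero =>
        change K.op (K.op (K.sphereOp 1 φ)) - (K.p + K.q) • K.sphereOp 1 φ - (K.q * (K.p + 1)) • φ
          = K.op (K.op (K.sphereOp 1 φ)) - (K.p + K.q) • K.sphereOp 1 φ
            - (K.p * K.q) • ((K.p + 1) / K.p) • φ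
        rw [smul_smul]
        congr 2
        field_simp
      | succ j => rfl
    · intro τ h1 h2 u m hu
      exact abs_le_of_linear_recurrence hp hq hε (by linarith) (by rw [hb] at h2; linarith) u m hu
    · intro j
      positivity

open Classical in
variable (K) in
/-- The indicator function of a point. -/
noncomputable def delta (o : ι) : K.Fun :=
  K.mkFun (fun a => if a = o then 1 else 0) 1 fun a => by split_ifs <;> simp

variable (K) in
/-- The indicator function of the first colour class. -/
noncomputable def even : K.Fun :=
  K.mkFun (fun a => bif K.col a then 1 else 0) 1 fun a => by cases K.col a <;> simp

theorem int_mul_delta (f : K.Fun) (o : ι) : K.int (f * K.delta o) = K.μ o * f o := by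
  classical
  rw [int_apply, tsum_eq_single o]
  · simp [delta]
  · intro a ha
    simp [delta, ha]

theorem int_even_pos {o : ι} (ho : K.col o = true) : 0 < K.int K.even := by
  refine lt_of_lt_of_le ?_ (mul_le_int (f := K.even) ?_ o)
  · simp [even, ho, K.μ_pos]
  · intro a
    simp only [even, mkFun_apply]
    cases K.col a <;> simp

/-- Exponentially fast equidistribution of spheres. -/
theorem abs_sphereOp_sub_le (hP : K.Poincare) {o : ι} (ho : K.col o = true) :
    ∃ r C : ℝ, 0 < r ∧ r < K.p * K.q ∧ 0 ≤ C ∧ ∀ k : ℕ,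
      |K.sphereOp k (K.delta o) o - K.μ o / K.int K.even * K.sphereOp k K.even o| ≤
        C * (k + 1) * r ^ k := by
  obtain ⟨r, C, hr, hrm, hC, h⟩ := abs_int_sphereOp_mul_le hP
  set c := K.μ o / K.int K.even with hc
  have hI := int_even_pos ho
  -- The part of the point mass orthogonal to the constants of the first colour class.
  let φ := K.delta o - c • K.even
  have hφ : φ ∈ K.evenMeanZero := by
    constructor
    · intro a ha
      have : a ≠ o := by rintro rfl; simp [ho] at ha
      simp [φ, delta, even, ha, this]
    · rw [map_sub, map_smul, ← one_mul (K.delta o), int_mul_delta, hc, smul_eq_mul, one_apply]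
      field_simp
      ring
  have hμ := K.μ_pos o
  have hpos : 0 ≤ K.int (φ * φ) := int_nonneg fun a => mul_self_nonneg (φ a)
  refine ⟨r, C * K.int (φ * φ) / K.μ o, hr, hrm, by positivity, fun k => ?_⟩
  have hk := h φ hφ k
  have hmem := sphereOp_mem hφ k
  -- The function `K.sphereOp k φ` lives on the first class and has mean zero, so the constant part
  -- of φ contributes nothing to the pairing and only the value at `o` is left.
  have e : K.int (K.sphereOp k φ * φ) =
      K.μ o * (K.sphereOp k (K.delta o) o - c * K.sphereOp k K.even o) := by
    have e1 : K.sphereOp k φ * K.even = K.sphereOp k φ := by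
      ext a
      rw [mul_apply]
      simp only [even, mkFun_apply]
      cases ha : K.col a
      · simp [hmem.1 a ha]
      · simp
    have e2 : K.sphereOp k φ * φ = K.sphereOp k φ * K.delta o - c • K.sphereOp k φ := by
      change _ * (_ - _) = _
      rw [mul_sub, mul_smul_comm, e1]
    rw [e2, map_sub, map_smul, hmem.2, smul_zero, sub_zero, int_mul_delta]
    congr 1
    change K.sphereOp k (K.delta o - c • K.even) o = _
    rw [map_sub, map_smul]
    rfl
  rw [e, abs_mul, abs_of_pos hμ] at hk
  have e3 : C * K.int (φ * φ) / K.μ o * (k + 1) * r ^ k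
      = C * (k + 1) * r ^ k * K.int (φ * φ) / K.μ o := by ring
  rw [e3, le_div_iff₀ hμ]
  linarith

end BipartiteKernel

/-! ### Poincaré inequality on graphs with finitely many rays of decaying mass -/

/-- Choosing a position on a ray for each vertex outside `S` embeds a finite set of such vertices
into finitely many initial segments, which have a common length. -/
theorem sum_le_of_rays {ι : Type*} {N : ℕ} (S : Finset ι) (x : Fin N → ℕ → ι)
    (hx : ∀ v, v ∉ S → ∃ i k, v = x i k) {h : ι → ℝ} (h0 : ∀ v, 0 ≤ h v) (B : Fin N → ℝ)
    (hB : ∀ i n, ∑ k ∈ Finset.range n, h (x i k) ≤ B i) (s : Finset ι) :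
    ∑ v ∈ s, h v ≤ ∑ v ∈ S, h v + ∑ i, B i := by
  classical
  have h1 : ∑ v ∈ s \ S, h v ≤ ∑ i, B i := by
    rcases isEmpty_or_nonempty (Fin N) with hN | hN
    · have : s \ S = ∅ := by
        refine Finset.eq_empty_of_forall_notMem fun v hv => ?_
        exact hN.elim (hx v (Finset.mem_sdiff.1 hv).2).choose
      simp [this]
    choose! i k hik using hx
    obtain ⟨M, hM⟩ := ((s \ S).image k).bddAbove
    have hinj : Set.InjOn (fun v => (i v, k v)) ((s \ S : Finset ι) : Set ι) := by
      intro v hv w hw hvw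
      rw [Finset.mem_coe, Finset.mem_sdiff] at hv hw
      rw [Prod.mk.injEq] at hvw
      rw [hik v hv.2, hik w hw.2, hvw.1, hvw.2]
    calc ∑ v ∈ s \ S, h v = ∑ v ∈ s \ S, h (x (i v) (k v)) := by
          refine Finset.sum_congr rfl fun v hv => ?_
          rw [← hik v (Finset.mem_sdiff.1 hv).2]
      _ = ∑ p ∈ (s \ S).image fun v => (i v, k v), h (x p.1 p.2) :=
          (Finset.sum_image (f := fun p : Fin N × ℕ => h (x p.1 p.2)) hinj).symm
      _ ≤ ∑ p ∈ Finset.univ ×ˢ Finset.range (M + 1), h (x p.1 p.2) := by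
          refine Finset.sum_le_sum_of_subset_of_nonneg ?_ fun _ _ _ => h0 _
          intro p hp
          obtain ⟨v, hv, rfl⟩ := Finset.mem_image.1 hp
          rw [Finset.mem_product, Finset.mem_range, Nat.lt_succ_iff]
          exact ⟨Finset.mem_univ _, hM (Finset.mem_coe.2 (Finset.mem_image_of_mem k hv))⟩
      _ = ∑ i, ∑ k ∈ Finset.range (M + 1), h (x i k) := Finset.sum_product ..
      _ ≤ ∑ i, B i := Finset.sum_le_sum fun i _ => hB i _
  calc ∑ v ∈ s, h v ≤ ∑ v ∈ S ∪ s \ S, h v := by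
        refine Finset.sum_le_sum_of_subset_of_nonneg ?_ fun _ _ _ => h0 _
        rw [Finset.union_sdiff_self_eq_union]
        exact Finset.subset_union_right
    _ = ∑ v ∈ S, h v + ∑ v ∈ s \ S, h v := Finset.sum_union Finset.disjoint_sdiff
    _ ≤ _ := add_le_add le_rfl h1

theorem summable_of_rays {ι : Type*} {N : ℕ} (S : Finset ι) (x : Fin N → ℕ → ι)
    (hx : ∀ v, v ∉ S → ∃ i k, v = x i k) {μ : ι → ℝ} (h0 : ∀ v, 0 ≤ μ v)
    (hμ : ∀ i k, 2 * μ (x i (k + 1)) ≤ μ (x i k)) : Summable μ := by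
  refine summable_of_sum_le h0 fun s => sum_le_of_rays S x hx h0 (fun i => 2 * μ (x i 0)) ?_ s
  intro i n
  -- The extra term 2μ(x i n) makes the geometric bound inductive.
  have : ∑ k ∈ Finset.range n, μ (x i k) + 2 * μ (x i n) ≤ 2 * μ (x i 0) := by
    induction n with
    | zero => simp
    | succ n ih =>
      rw [Finset.sum_range_succ]
      have := hμ i n
      linarith
  have := h0 (x i n)
  linarith

/-- A discrete Hardy inequality. -/
theorem hardy_sum_le {μ a d : ℕ → ℝ} (hμ0 : ∀ k, 0 ≤ μ k) (hμ : ∀ k, 2 * μ (k + 1) ≤ μ k)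
    (ha : ∀ k, a (k + 1) = a k + d k) (n : ℕ) :
    ∑ k ∈ Finset.range n, μ k * a k ^ 2 ≤
      4 * (μ 0 * a 0 ^ 2) + 6 * ∑ k ∈ Finset.range n, μ k * d k ^ 2 := by
  -- The induction carries the boundary term 4μ_n a_n². From (a + d)² ≤ (3/2)a² + 3d² and 2μ_{n+1} ≤
  -- μ_n, the new boundary term is at most 3μ_n a_n² + 6μ_n d_n². The old one pays for this and for
  -- the new summand μ_n a_n², as 3 + 1 = 4.
  have : ∑ k ∈ Finset.range n, μ k * a k ^ 2 + 4 * (μ n * a n ^ 2) ≤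
      4 * (μ 0 * a 0 ^ 2) + 6 * ∑ k ∈ Finset.range n, μ k * d k ^ 2 := by
    induction n with
    | zero => simp
    | succ n ih =>
      rw [Finset.sum_range_succ, Finset.sum_range_succ]
      have h1 : a (n + 1) ^ 2 ≤ 3 / 2 * a n ^ 2 + 3 * d n ^ 2 := by
        rw [ha]
        nlinarith [sq_nonneg (a n - 2 * d n)]
      have h2 : μ (n + 1) * a (n + 1) ^ 2 ≤ μ (n + 1) * (3 / 2 * a n ^ 2 + 3 * d n ^ 2) :=
        mul_le_mul_of_nonneg_left h1 (hμ0 _)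
      have h3 : 2 * μ (n + 1) * (3 / 2 * a n ^ 2 + 3 * d n ^ 2) ≤
          μ n * (3 / 2 * a n ^ 2 + 3 * d n ^ 2) :=
        mul_le_mul_of_nonneg_right (hμ n) (by positivity)
      linarith
  have h4 := mul_nonneg (hμ0 n) (sq_nonneg (a n))
  linarith

namespace BipartiteKernel

variable {ι : Type*} {K : BipartiteKernel ι}

theorem sub_sq_le_int_grad (f : K.Fun) (a b : ι) :
    K.μ a * (K.n a b * (f b - f a) ^ 2) ≤ K.int (grad f) :=
  (mul_le_mul_of_nonneg_left (mul_sq_le_grad f a b) (K.μ_pos a).le).trans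
    (mul_le_int (grad_nonneg f) a)

/-- Each edge of a path from `x₀` to `a` carries positive weight, so the Dirichlet form controls the
increment of `f` along it. -/
theorem exists_sub_sq_le {x₀ a : ι} (h : Relation.ReflTransGen (fun a b => 0 < K.n a b) x₀ a) :
    ∃ C : ℝ, 0 ≤ C ∧ ∀ f : K.Fun, (f a - f x₀) ^ 2 ≤ C * K.int (grad f) := by
  induction h with
  | refl => exact ⟨0, le_rfl, fun f => by simp⟩
  | @tail a b _ hab ih =>
    obtain ⟨C, hC, h⟩ := ih
    have hw : 0 < K.μ a * K.n a b := mul_pos (K.μ_pos a) hab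
    refine ⟨2 * C + 2 / (K.μ a * K.n a b), by positivity, fun f => ?_⟩
    have h1 := h f
    have h2 : (f b - f a) ^ 2 ≤ K.int (grad f) / (K.μ a * K.n a b) := by
      rw [le_div_iff₀ hw]
      have := sub_sq_le_int_grad f a b
      linarith
    calc (f b - f x₀) ^ 2 ≤ 2 * (f a - f x₀) ^ 2 + 2 * (f b - f a) ^ 2 := by
          nlinarith [sq_nonneg ((f a - f x₀) - (f b - f a))]
      _ ≤ 2 * (C * K.int (grad f)) + 2 * (K.int (grad f) / (K.μ a * K.n a b)) := by linarith
      _ = _ := by ring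

/-- On the finite set, and at the first vertex of each ray, f - f x₀ is controlled along paths. From
there the Hardy inequality controls it along the whole ray, the increments being bounded by the
gradient because consecutive ray vertices have kernel at least 1. -/
theorem poincare_of_rays (x₀ : ι)
    (hconn : ∀ a, Relation.ReflTransGen (fun a b => 0 < K.n a b) x₀ a) {N : ℕ} (S : Finset ι)
    (x : Fin N → ℕ → ι) (hx : ∀ v, v ∉ S → ∃ i k, v = x i k)
    (hinj : ∀ i, Function.Injective (x i)) (hμ : ∀ i k, 2 * K.μ (x i (k + 1)) ≤ K.μ (x i k))
    (hn : ∀ i k, 1 ≤ K.n (x i k) (x i (k + 1))) : K.Poincare := by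
  choose C hC h using fun a => exists_sub_sq_le (hconn a)
  have hμ0 := fun a => (K.μ_pos a).le
  refine ⟨x₀, ∑ v ∈ S, K.μ v * C v + ∑ i, (4 * (K.μ (x i 0) * C (x i 0)) + 6) + 1, ?_, fun f => ?_⟩
  · have h1 : 0 ≤ ∑ v ∈ S, K.μ v * C v := Finset.sum_nonneg fun v _ => mul_nonneg (hμ0 v) (hC v)
    have h2 : 0 ≤ ∑ i, (4 * (K.μ (x i 0) * C (x i 0)) + 6) :=
      Finset.sum_nonneg fun i _ => by
        have := mul_nonneg (hμ0 (x i 0)) (hC (x i 0))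
        linarith
    linarith
  set D := K.int (grad f) with hD
  have hD0 : 0 ≤ D := int_nonneg (grad_nonneg f)
  have hh0 : ∀ v, 0 ≤ K.μ v * (f v - f x₀) ^ 2 := fun v => mul_nonneg (hμ0 v) (sq_nonneg _)
  have hint : K.int ((f - f x₀ • (1 : K.Fun)) * (f - f x₀ • (1 : K.Fun)))
      = ∑' v, K.μ v * (f v - f x₀) ^ 2 := by
    rw [int_apply]
    refine tsum_congr fun v => ?_
    simp only [mul_apply, sub_apply, smul_apply, one_apply]
    ring
  rw [hint]
  refine (Real.tsum_le_of_sum_le hh0 fun s => sum_le_of_rays S x hx hh0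
    (fun i => (4 * (K.μ (x i 0) * C (x i 0)) + 6) * D) ?_ s).trans ?_
  · intro i n
    refine (hardy_sum_le (μ := fun k => K.μ (x i k)) (a := fun k => f (x i k) - f x₀)
      (d := fun k => f (x i (k + 1)) - f (x i k)) (fun k => hμ0 _) (hμ i)
      (fun k => by ring) n).trans ?_
    have h1 : K.μ (x i 0) * (f (x i 0) - f x₀) ^ 2 ≤ K.μ (x i 0) * (C (x i 0) * D) :=
      mul_le_mul_of_nonneg_left (h _ f) (hμ0 _)
    have h2 : ∑ k ∈ Finset.range n, K.μ (x i k) * (f (x i (k + 1)) - f (x i k)) ^ 2 ≤ D := by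
      calc _ ≤ ∑ k ∈ Finset.range n, K.μ (x i k) * grad f (x i k) := by
            refine Finset.sum_le_sum fun k _ => mul_le_mul_of_nonneg_left ?_ (hμ0 _)
            exact (le_mul_of_one_le_left (sq_nonneg _) (hn i k)).trans (mul_sq_le_grad f _ _)
        _ = ∑ v ∈ (Finset.range n).map ⟨x i, hinj i⟩, K.μ v * grad f v := by
            rw [Finset.sum_map]; rfl
        _ ≤ D := (summable_mul (grad f)).sum_le_tsum _ fun v _ =>
            mul_nonneg (hμ0 v) (grad_nonneg f v)
    linarith
  · rw [← Finset.sum_mul, add_mul, add_mul]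
    have h1 : ∑ v ∈ S, K.μ v * (f v - f x₀) ^ 2 ≤ (∑ v ∈ S, K.μ v * C v) * D := by
      rw [Finset.sum_mul]
      refine Finset.sum_le_sum fun v _ => ?_
      rw [mul_assoc]
      exact mul_le_mul_of_nonneg_left (h v f) (hμ0 v)
    linarith

end BipartiteKernel

/-! ### The action of a group of tree automorphisms -/

section Action

variable {V : Type*} {T : SimpleGraph V}

theorem adj_smul_iff (g : TreeAut T) {u v : V} : T.Adj (g • u) (g • v) ↔ T.Adj u v :=
  g.1.map_adj_iff

theorem dist_smul_smul (hT : T.Connected) (g : TreeAut T) (u v : V) :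
    T.dist (g • u) (g • v) = T.dist u v := by
  have key : ∀ (g : TreeAut T) (u v : V), T.dist (g • u) (g • v) ≤ T.dist u v := by
    intro g u v
    obtain ⟨p, hp⟩ := hT.exists_walk_length_eq_dist u v
    rw [← hp, ← SimpleGraph.Walk.length_map g.1.toHom p]
    exact SimpleGraph.dist_le _
  refine le_antisymm (key g u v) ?_
  have := key g⁻¹ (g • u) (g • v)
  rwa [inv_smul_smul, inv_smul_smul] at this

theorem color_smul (c : T.Coloring Bool) (g : TreeAut T) (v : V) : c (g • v) = c v := by
  obtain ⟨p, hp⟩ := g.2 v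
  have := (c.even_length_iff_congr p).1 hp
  exact Bool.eq_iff_iff.2 this

theorem isOpen_setOf_smul_eq (v w : V) : IsOpen {g : TreeAut T | g • v = w} := by
  let _ : TopologicalSpace V := ⊥
  have : DiscreteTopology V := ⟨rfl⟩
  have h1 : Continuous fun g : T ≃g T => (g : V → V) := continuous_induced_dom
  have h2 : Continuous fun g : TreeAut T => (g.1 : V → V) v :=
    (continuous_apply v).comp (h1.comp continuous_subtype_val)
  exact (isOpen_discrete {w}).preimage h2

theorem exists_finset_of_isOpen {O : Set (TreeAut T)} (hO : IsOpen O) {g : TreeAut T}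
    (hg : g ∈ O) : ∃ F : Finset V, ∀ h : TreeAut T, (∀ v ∈ F, h • v = g • v) → h ∈ O := by
  let _ : TopologicalSpace V := ⊥
  obtain ⟨O₁, hO₁, rfl⟩ := isOpen_induced_iff.1 hO
  obtain ⟨O₂, hO₂, rfl⟩ := isOpen_induced_iff.1 hO₁
  obtain ⟨F, u, hu, hF⟩ := isOpen_pi_iff.1 hO₂ _ hg
  refine ⟨F, fun h hh => hF fun v hv => ?_⟩
  have : (h.1 : V → V) v = (g.1 : V → V) v := hh v hv
  change (h.1 : V → V) v ∈ u v
  rw [this]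
  exact (hu v hv).2

variable (Γ : Subgroup (TreeAut T))

/-- By discreteness some finite set `F` of vertices is fixed pointwise only by the identity of Γ. An
element of the stabilizer of `v` is thus determined by its values on `F`, each of which lies on a
finite sphere around `v`. -/
theorem finite_stabilizer_of_discrete (hT : T.Connected) (hfin : ∀ v, (T.neighborSet v).Finite)
    (hΓ : DiscreteTopology Γ) (v : V) : Finite (MulAction.stabilizer Γ v) := by
  obtain ⟨O, hO, hO1⟩ := isOpen_induced_iff.1 (isOpen_discrete ({1} : Set Γ))
  have h1 : (1 : TreeAut T) ∈ O := by
    have : (1 : Γ) ∈ (Subtype.val ⁻¹' O : Set Γ) := by rw [hO1]; rfl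
    exact this
  obtain ⟨F, hF⟩ := exists_finset_of_isOpen hO h1
  let f : MulAction.stabilizer Γ v → (w : F) → T.sphere v (T.dist v w) := fun γ w =>
    ⟨γ.1 • w.1, by
      rw [SimpleGraph.mem_sphere hT hfin]
      have h2 := dist_smul_smul hT γ.1.1 v w
      have h3 : γ.1.1 • v = v := γ.2
      rw [h3] at h2
      exact h2⟩
  refine Finite.of_injective f fun γ γ' h => ?_
  have h2 : γ.1⁻¹ * γ'.1 ∈ (Subtype.val ⁻¹' O : Set Γ) := by
    refine hF _ fun w hw => ?_
    have h3 : γ.1 • w = γ'.1 • w := congrArg Subtype.val (congrFun h ⟨w, hw⟩)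
    change (γ.1⁻¹ * γ'.1) • w = _
    rw [mul_smul, ← h3, inv_smul_smul, one_smul]
  rw [hO1] at h2
  exact Subtype.ext (inv_mul_eq_one.1 h2)

theorem quotVert_smul (γ : Γ) (v : V) : quotVert Γ (γ • v) = quotVert Γ v :=
  Quotient.sound ⟨γ, rfl⟩

theorem quotVert_eq_iff {v w : V} : quotVert Γ v = quotVert Γ w ↔ ∃ γ : Γ, γ • w = v := by
  refine ⟨fun h => Quotient.exact h, ?_⟩
  rintro ⟨γ, rfl⟩
  exact quotVert_smul Γ γ w

theorem quotVert_out (a : QuotVert Γ) : quotVert Γ a.out = a := Quotient.out_eq a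

theorem exists_smul_eq_out (v : V) : ∃ γ : Γ, γ • v = (quotVert Γ v).out :=
  (quotVert_eq_iff Γ).1 (quotVert_out Γ _)

theorem sum_sphere_smul (hT : T.Connected) (hfin : ∀ v, (T.neighborSet v).Finite) (γ : Γ) (v : V)
    (k : ℕ) (f : QuotVert Γ → ℝ) :
    ∑ w ∈ T.sphere (γ • v) k, f (quotVert Γ w) = ∑ w ∈ T.sphere v k, f (quotVert Γ w) := by
  refine Finset.sum_nbij' (fun w => γ⁻¹ • w) (fun w => γ • w) ?_ ?_ ?_ ?_ ?_
  · intro w hw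
    rw [SimpleGraph.mem_sphere hT hfin] at hw ⊢
    rw [← hw, ← dist_smul_smul hT γ.1 v]
    exact congrArg _ (smul_inv_smul γ w)
  · intro w hw
    rw [SimpleGraph.mem_sphere hT hfin] at hw ⊢
    rw [← hw]
    exact dist_smul_smul hT γ.1 v w
  · exact fun w _ => smul_inv_smul γ w
  · exact fun w _ => inv_smul_smul γ w
  · intro w _
    rw [quotVert_smul]

/-- The inverse of the order of the stabilizer of a lift of a vertex of `Γ \ T`. -/
noncomputable def vertMass (a : QuotVert Γ) : ℝ := (Nat.card (MulAction.stabilizer Γ a.out) : ℝ)⁻¹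

theorem vertMass_quotVert (v : V) :
    vertMass Γ (quotVert Γ v) = (Nat.card (MulAction.stabilizer Γ v) : ℝ)⁻¹ := by
  obtain ⟨γ, hγ⟩ := exists_smul_eq_out Γ v
  rw [vertMass, ← hγ]
  rw [Nat.card_congr (MulAction.stabilizerEquivStabilizer (g := γ) (a := v) rfl).toEquiv]

theorem toReal_orbitMass (a : QuotVert Γ) [Finite (MulAction.stabilizer Γ a.out)] :
    (orbitMass Γ a.out).toReal = vertMass Γ a := by
  rw [orbitMass, ENat.card_eq_coe_natCard, vertMass, ENNReal.toReal_inv]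
  simp

theorem orbitMass_eq_ofReal (a : QuotVert Γ) [Finite (MulAction.stabilizer Γ a.out)] :
    orbitMass Γ a.out = ENNReal.ofReal (vertMass Γ a) := by
  rw [← toReal_orbitMass, ENNReal.ofReal_toReal]
  rw [orbitMass, ENat.card_eq_coe_natCard]
  have : Nat.card (MulAction.stabilizer Γ a.out) ≠ 0 := Nat.card_pos.ne'
  simpa using this

theorem vertMass_pos (a : QuotVert Γ) [Finite (MulAction.stabilizer Γ a.out)] :
    0 < vertMass Γ a := inv_pos.2 (Nat.cast_pos.2 Nat.card_pos)

open Classical in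
/-- The number of neighbours of a lift of `a` that project to `b`. -/
noncomputable def vertKernel (a b : QuotVert Γ) : ℝ :=
  ((T.sphere a.out 1).filter fun w => quotVert Γ w = b).card

theorem hasFiniteSupport_vertKernel (a : QuotVert Γ) :
    (Function.support (vertKernel Γ a)).Finite := by
  classical
  refine ((T.sphere a.out 1).image (quotVert Γ)).finite_toSet.subset fun b hb => ?_
  rw [Function.mem_support, vertKernel, Nat.cast_ne_zero, Finset.card_ne_zero] at hb
  obtain ⟨w, hw⟩ := hb
  rw [Finset.mem_filter] at hw
  rw [Finset.mem_coe, Finset.mem_image]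
  exact ⟨w, hw⟩

/-- On the quotient the kernel acts as the adjacency operator of T does on Γ-invariant functions. -/
theorem tsum_vertKernel_mul (hT : T.Connected) (hfin : ∀ v, (T.neighborSet v).Finite)
    (f : QuotVert Γ → ℝ) (v : V) :
    ∑' b, vertKernel Γ (quotVert Γ v) b * f b = ∑ w ∈ T.sphere v 1, f (quotVert Γ w) := by
  classical
  obtain ⟨γ, hγ⟩ := exists_smul_eq_out Γ v
  rw [← sum_sphere_smul Γ hT hfin γ v, hγ, Finset.sum_comp f (quotVert Γ),
    tsum_eq_sum (s := (T.sphere (quotVert Γ v).out 1).image (quotVert Γ))]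
  · refine Finset.sum_congr rfl fun b _ => ?_
    rw [nsmul_eq_mul, vertKernel]
  · intro b hb
    have : vertKernel Γ (quotVert Γ v) b = 0 := by
      rw [vertKernel, Nat.cast_eq_zero, Finset.card_eq_zero, Finset.filter_eq_empty_iff]
      intro w hw hwb
      exact hb (Finset.mem_image.2 ⟨w, hw, hwb⟩)
    rw [this, zero_mul]

theorem one_le_vertKernel (hT : T.Connected) (hfin : ∀ v, (T.neighborSet v).Finite) {v w : V}
    (h : T.Adj v w) : 1 ≤ vertKernel Γ (quotVert Γ v) (quotVert Γ w) := by
  classical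
  obtain ⟨γ, hγ⟩ := exists_smul_eq_out Γ v
  rw [vertKernel, ← hγ, Nat.one_le_cast, Nat.one_le_iff_ne_zero, Finset.card_ne_zero]
  refine ⟨γ • w, ?_⟩
  rw [Finset.mem_filter, SimpleGraph.mem_sphere_one hT hfin]
  exact ⟨(adj_smul_iff γ.1).2 h, quotVert_smul Γ γ w⟩

/-- Mass transport for the indicator of the oriented edges of T that run from the orbit `a` to the
orbit `b`. -/
theorem vertMass_mul_vertKernel (hT : T.Connected) (hfin : ∀ v, (T.neighborSet v).Finite)
    [∀ v : V, Finite (MulAction.stabilizer Γ v)] (a b : QuotVert Γ) :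
    vertMass Γ a * vertKernel Γ a b = vertMass Γ b * vertKernel Γ b a := by
  classical
  let F : V → V → ℝ≥0∞ := fun v w =>
    if T.Adj v w ∧ quotVert Γ v = a ∧ quotVert Γ w = b then 1 else 0
  have hF : ∀ (γ : Γ) v w, F (γ • v) (γ • w) = F v w := by
    intro γ v w
    simp only [F, quotVert_smul]
    congr 2
    exact propext (adj_smul_iff γ.1)
  have key := mass_transport (G := Γ) F hF
  have h1 : ∑' c : QuotVert Γ, orbitMass Γ c.out * ∑' y, F c.out y
      = ENNReal.ofReal (vertMass Γ a * vertKernel Γ a b) := by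
    rw [tsum_eq_single a]
    · rw [orbitMass_eq_ofReal, ENNReal.ofReal_mul (vertMass_pos Γ a).le]
      congr 1
      rw [vertKernel, ENNReal.ofReal_natCast, Finset.card_eq_sum_ones, Nat.cast_sum,
        Finset.sum_filter, tsum_eq_sum (s := T.sphere a.out 1)]
      · refine Finset.sum_congr rfl fun w hw => ?_
        rw [SimpleGraph.mem_sphere_one hT hfin] at hw
        simp [F, hw, quotVert_out]
      · intro w hw
        rw [SimpleGraph.mem_sphere_one hT hfin] at hw
        simp [F, hw]
    · intro c hc
      simp [F, quotVert_out, hc]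
  have h2 : ∑' c : QuotVert Γ, orbitMass Γ c.out * ∑' y, F y c.out
      = ENNReal.ofReal (vertMass Γ b * vertKernel Γ b a) := by
    rw [tsum_eq_single b]
    · rw [orbitMass_eq_ofReal, ENNReal.ofReal_mul (vertMass_pos Γ b).le]
      congr 1
      rw [vertKernel, ENNReal.ofReal_natCast, Finset.card_eq_sum_ones, Nat.cast_sum,
        Finset.sum_filter, tsum_eq_sum (s := T.sphere b.out 1)]
      · refine Finset.sum_congr rfl fun w hw => ?_
        rw [SimpleGraph.mem_sphere_one hT hfin] at hw
        simp [F, hw.symm, quotVert_out]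
      · intro w hw
        rw [SimpleGraph.mem_sphere_one hT hfin] at hw
        have hw' : ¬ T.Adj w b.out := fun h => hw h.symm
        simp [F, hw']
    · intro c hc
      simp [F, quotVert_out, hc]
  rw [h1, h2] at key
  refine (ENNReal.ofReal_eq_ofReal_iff ?_ ?_).1 key
  · exact mul_nonneg (vertMass_pos Γ a).le (Nat.cast_nonneg _)
  · exact mul_nonneg (vertMass_pos Γ b).le (Nat.cast_nonneg _)

/-! ### Nagao rays -/

theorem liftInd_mul_card (e : T.Dart) :
    liftInd Γ e * Nat.card (MulAction.stabilizer Γ e) =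
      Nat.card (MulAction.stabilizer Γ e.fst) := by
  have hle : MulAction.stabilizer Γ e ≤ MulAction.stabilizer Γ e.fst := by
    intro γ hγ
    exact congrArg (fun e : T.Dart => e.fst) (MulAction.mem_stabilizer_iff.1 hγ)
  rw [liftInd, mul_comm, ← Subgroup.relIndex_bot_left, ← Subgroup.relIndex_bot_left,
    Subgroup.relIndex_mul_relIndex _ _ _ bot_le hle]

theorem stabilizer_dart_symm (e : T.Dart) :
    MulAction.stabilizer Γ e.symm = MulAction.stabilizer Γ e := by
  ext γ
  rw [MulAction.mem_stabilizer_iff, MulAction.mem_stabilizer_iff]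
  change (γ • e).symm = e.symm ↔ _
  exact SimpleGraph.Dart.symm_involutive.injective.eq_iff

theorem quotEdge_eq_iff {e e' : T.Dart} : quotEdge Γ e = quotEdge Γ e' ↔ ∃ γ : Γ, γ • e' = e := by
  refine ⟨fun h => Quotient.exact h, ?_⟩
  rintro ⟨γ, rfl⟩
  exact Quotient.sound ⟨γ, rfl⟩

theorem liftInd_eq_ncard_orbit (e : T.Dart) :
    liftInd Γ e = (MulAction.orbit (MulAction.stabilizer Γ e.fst) e.snd).ncard := by
  rw [← MulAction.index_stabilizer, liftInd, Subgroup.relIndex]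
  congr 1
  ext γ
  rw [Subgroup.mem_subgroupOf, MulAction.mem_stabilizer_iff, MulAction.mem_stabilizer_iff]
  constructor
  · intro h
    exact congrArg (fun e : T.Dart => e.snd) h
  · intro h
    exact SimpleGraph.Dart.ext _ _ (Prod.ext (show γ.1 • e.fst = e.fst from γ.2) h)

/-- The neighbours of `v` leading to a given edge of the quotient form one orbit of the stabilizer
of `v`, and the size of this orbit is the index of that edge. -/
theorem deg_quotGraph (hT : T.Connected) (hfin : ∀ v, (T.neighborSet v).Finite) (v : V) :
    (quotGraph Γ).deg (quotVert Γ v) = (T.sphere v 1).card := by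
  classical
  have hadj : ∀ w : T.sphere v 1, T.Adj v w := fun w =>
    (SimpleGraph.mem_sphere_one hT hfin).1 w.2
  let f : T.sphere v 1 → QuotEdge Γ := fun w => quotEdge Γ ⟨(v, w), hadj w⟩
  have himg : {e : QuotEdge Γ | (quotGraph Γ).src e = quotVert Γ v}
      = ((Finset.univ.image f : Finset (QuotEdge Γ)) : Set (QuotEdge Γ)) := by
    ext e
    rw [Finset.mem_coe, Finset.mem_image]
    constructor
    · obtain ⟨e, rfl⟩ := Quotient.exists_rep e
      intro h
      obtain ⟨γ, hγ⟩ := (quotVert_eq_iff Γ).1 (Eq.symm h : quotVert Γ v = quotVert Γ e.fst)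
      have h1 : T.Adj v (γ • e.snd) := by
        rw [← hγ]
        exact (adj_smul_iff γ.1).2 e.adj
      refine ⟨⟨γ • e.snd, (SimpleGraph.mem_sphere_one hT hfin).2 h1⟩, Finset.mem_univ _, ?_⟩
      exact (quotEdge_eq_iff Γ).2 ⟨γ, SimpleGraph.Dart.ext _ _ (Prod.ext hγ rfl)⟩
    · rintro ⟨w, -, rfl⟩
      rfl
  rw [EdgeIndexedGraph.deg, himg, finsum_mem_coe_finset, ← Fintype.card_coe, ← Finset.card_univ,
    Finset.card_eq_sum_card_image f]
  refine Finset.sum_congr rfl fun e he => ?_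
  obtain ⟨w, -, rfl⟩ := Finset.mem_image.1 he
  change liftInd Γ ⟨(v, w), hadj w⟩ = _
  rw [liftInd_eq_ncard_orbit, ← Finset.card_map ⟨Subtype.val, Subtype.val_injective⟩,
    ← Set.ncard_coe_finset]
  congr 1
  ext u
  rw [Finset.mem_coe, Finset.mem_map]
  constructor
  · rintro ⟨γ, rfl⟩
    have hγ : γ.1 • v = v := γ.2
    have h1 : T.Adj v (γ.1 • w.1) := by
      have := (adj_smul_iff γ.1.1).2 (hadj w)
      have h3 : γ.1.1 • v = v := hγ
      rwa [h3] at this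
    refine ⟨⟨γ.1 • w.1, (SimpleGraph.mem_sphere_one hT hfin).2 h1⟩, ?_, rfl⟩
    rw [Finset.mem_filter]
    exact ⟨Finset.mem_univ _, (quotEdge_eq_iff Γ).2
      ⟨γ.1, SimpleGraph.Dart.ext _ _ (Prod.ext hγ rfl)⟩⟩
  · rintro ⟨u, hu, rfl⟩
    rw [Finset.mem_filter] at hu
    obtain ⟨γ, hγ⟩ := (quotEdge_eq_iff Γ).1 hu.2
    exact ⟨⟨γ, congrArg (fun e : T.Dart => e.fst) hγ⟩, congrArg (fun e : T.Dart => e.snd) hγ⟩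

theorem one_le_vertKernel_of_isNagaoRay (hT : T.Connected)
    (hfin : ∀ v, (T.neighborSet v).Finite) {x : ℕ → QuotVert Γ} {e : ℕ → QuotEdge Γ}
    (h : (quotGraph Γ).IsNagaoRay x e) (k : ℕ) : 1 ≤ vertKernel Γ (x k) (x (k + 1)) := by
  rw [← h.tgt_eq, ← h.src_eq]
  obtain ⟨e', he'⟩ := Quotient.exists_rep (e k)
  rw [← he']
  exact one_le_vertKernel Γ hT hfin e'.adj

/-- Index 1 towards infinity means that the stabilizer of the edge is that of its initial vertex. In
the stabilizer of the terminal vertex it has index the valency minus one, which is at least 2. The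
shift by one avoids the edge at the origin, whose index is arbitrary. -/
theorem two_mul_vertMass_le_of_isNagaoRay (hT : T.Connected)
    (hfin : ∀ v, (T.neighborSet v).Finite) [∀ v : V, Finite (MulAction.stabilizer Γ v)]
    (h3 : ∀ v, 3 ≤ (T.sphere v 1).card) {x : ℕ → QuotVert Γ} {e : ℕ → QuotEdge Γ}
    (h : (quotGraph Γ).IsNagaoRay x e) (k : ℕ) :
    2 * vertMass Γ (x (k + 2)) ≤ vertMass Γ (x (k + 1)) := by
  have h1 := h.ind_out k
  have h2 := h.ind_in (k + 1)
  rw [← h.tgt_eq, ← h.src_eq]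
  rw [← h.tgt_eq] at h2
  obtain ⟨e', he'⟩ := Quotient.exists_rep (e (k + 1))
  rw [← he'] at h1 h2 ⊢
  change liftInd Γ e' = 1 at h1
  change liftInd Γ e'.symm + 1 = (quotGraph Γ).deg (quotVert Γ e'.snd) at h2
  change 2 * vertMass Γ (quotVert Γ e'.snd) ≤ vertMass Γ (quotVert Γ e'.fst)
  rw [deg_quotGraph Γ hT hfin] at h2
  have h4 := h3 e'.snd
  have h5 := liftInd_mul_card Γ e'
  have h6 := liftInd_mul_card Γ e'.symm
  rw [stabilizer_dart_symm] at h6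
  change _ = Nat.card (MulAction.stabilizer Γ e'.snd) at h6
  rw [h1, one_mul] at h5
  rw [h5] at h6
  rw [vertMass_quotVert, vertMass_quotVert, ← h6, Nat.cast_mul, mul_inv, ← mul_assoc]
  refine mul_le_of_le_one_left (inv_nonneg.2 (Nat.cast_nonneg _)) ?_
  have h7 : (2 : ℝ) ≤ (liftInd Γ e'.symm : ℝ) := by
    have : 2 ≤ liftInd Γ e'.symm := by omega
    exact_mod_cast this
  rw [← div_eq_mul_inv, div_le_one (by linarith)]
  exact h7

end Action

/-! ### The kernel of a quotient graph -/

section QuotKernel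

variable {V : Type*} {T : SimpleGraph V}

theorem neighborSet_finite {c : T.Coloring Bool} {d : Bool → ℕ}
    (hd : ∀ v, (T.neighborSet v).encard = d (c v)) (v : V) : (T.neighborSet v).Finite :=
  Set.finite_of_encard_eq_coe (hd v)

theorem card_sphere_one (hT : T.Connected) {c : T.Coloring Bool} {d : Bool → ℕ}
    (hd : ∀ v, (T.neighborSet v).encard = d (c v)) (v : V) : (T.sphere v 1).card = d (c v) := by
  have h : ((T.sphere v 1 : Finset V) : Set V) = T.neighborSet v := by
    ext w
    rw [Finset.mem_coe, SimpleGraph.mem_sphere_one hT (neighborSet_finite hd)]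
    rfl
  have := hd v
  rw [← h, Set.encard_coe_eq_coe_finsetCard] at this
  exact_mod_cast this

theorem color_eq_iff_even_dist (hT : T.IsTree) (c : T.Coloring Bool) (v w : V) :
    c v = c w ↔ Even (T.dist v w) := by
  obtain ⟨p, hp⟩ := hT.connected.exists_walk_length_eq_dist v w
  rw [← hp, c.even_length_iff_congr p, Bool.eq_iff_iff]

theorem color_out (c : T.Coloring Bool) (Γ : Subgroup (TreeAut T)) (v : V) :
    c (quotVert Γ v).out = c v := by
  obtain ⟨γ, hγ⟩ := exists_smul_eq_out Γ v
  rw [← hγ]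
  exact color_smul c γ.1 v

/-- Every neighbour of a vertex of the sphere, except its parent, lies on the next sphere, and
distinct vertices have disjoint sets of children. -/
theorem sub_one_mul_card_sphere_le (hT : T.IsTree) {c : T.Coloring Bool} {d : Bool → ℕ}
    (hd : ∀ v, (T.neighborSet v).encard = d (c v)) (v : V) (n : ℕ) {i : Bool}
    (hi : ∀ w ∈ T.sphere v n, c w = i) :
    (d i - 1) * (T.sphere v n).card ≤ (T.sphere v (n + 1)).card := by
  classical
  have hc := hT.connected
  have hfin := neighborSet_finite hd
  have hmaps : ∀ w ∈ T.sphere v (n + 1), hT.toward w v ∈ T.sphere v n := by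
    intro w hw
    rw [SimpleGraph.mem_sphere hc hfin] at hw ⊢
    have hwv : w ≠ v := by rintro rfl; simp at hw
    have := hT.dist_toward hwv
    rw [SimpleGraph.dist_comm (u := w), hw] at this
    rw [SimpleGraph.dist_comm]
    omega
  rw [Finset.card_eq_sum_card_fiberwise hmaps, mul_comm, ← smul_eq_mul]
  refine Finset.card_nsmul_le_sum _ _ _ fun w hw => ?_
  rw [← hi w hw, ← card_sphere_one hc hd w]
  refine (Finset.pred_card_le_card_erase (a := hT.toward w v)).trans (Finset.card_le_card ?_)
  intro u hu
  rw [Finset.mem_erase, SimpleGraph.mem_sphere_one hc hfin] at hu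
  have h1 := hT.dist_adj_of_ne_toward hu.2 hu.1
  rw [SimpleGraph.mem_sphere hc hfin] at hw
  rw [Finset.mem_filter, SimpleGraph.mem_sphere hc hfin]
  refine ⟨?_, ?_⟩
  · rw [SimpleGraph.dist_comm, h1, SimpleGraph.dist_comm, hw]
  · exact (hT.eq_toward hu.2.symm h1.symm).symm

theorem pow_le_card_sphere (hT : T.IsTree) {c : T.Coloring Bool} {d : Bool → ℕ}
    (hd : ∀ v, (T.neighborSet v).encard = d (c v)) (v : V) (k : ℕ) :
    ((d (c v) - 1) * (d (!(c v)) - 1)) ^ k ≤ (T.sphere v (2 * k)).card := by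
  have hc := hT.connected
  have hfin := neighborSet_finite hd
  induction k with
  | zero => simp [SimpleGraph.sphere_zero hc hfin]
  | succ k ih =>
    have h1 := sub_one_mul_card_sphere_le hT hd v (2 * k) (i := c v) (by
      intro w hw
      rw [SimpleGraph.mem_sphere hc hfin] at hw
      refine ((color_eq_iff_even_dist hT c v w).2 ?_).symm
      rw [hw]
      exact even_two_mul k)
    have h2 := sub_one_mul_card_sphere_le hT hd v (2 * k + 1) (i := !(c v)) (by
      intro w hw
      rw [SimpleGraph.mem_sphere hc hfin] at hw
      have : ¬ c v = c w := by
        rw [color_eq_iff_even_dist hT, hw, Nat.not_even_iff_odd]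
        exact odd_two_mul_add_one k
      revert this
      cases c v <;> cases c w <;> simp)
    calc ((d (c v) - 1) * (d (!(c v)) - 1)) ^ (k + 1)
        = (d (!(c v)) - 1) * ((d (c v) - 1) * ((d (c v) - 1) * (d (!(c v)) - 1)) ^ k) := by ring
      _ ≤ (d (!(c v)) - 1) * ((d (c v) - 1) * (T.sphere v (2 * k)).card) := by gcongr
      _ ≤ (d (!(c v)) - 1) * (T.sphere v (2 * k + 1)).card := by gcongr
      _ ≤ _ := h2

/-- The kernel on the vertices of `Γ \ T` that counts neighbours; the colour classes are those of
the vertices of `T` of colour `i` and of the other colour. -/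
noncomputable def quotKernel (hT : T.IsTree) (c : T.Coloring Bool) {d : Bool → ℕ}
    (hd : ∀ v, (T.neighborSet v).encard = d (c v)) (hd3 : ∀ i, 3 ≤ d i)
    (Γ : Subgroup (TreeAut T)) [∀ v : V, Finite (MulAction.stabilizer Γ v)]
    (hs : Summable (vertMass Γ)) (i : Bool) : BipartiteKernel (QuotVert Γ) where
  μ := vertMass Γ
  n := vertKernel Γ
  col a := c a.out == i
  p := d i - 1
  q := d (!i) - 1
  μ_pos a := vertMass_pos Γ a
  μ_summable := hs
  n_nonneg a b := Nat.cast_nonneg _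
  n_finite a := hasFiniteSupport_vertKernel Γ a
  row_sum a := by
    have h := tsum_vertKernel_mul Γ hT.connected (neighborSet_finite hd) 1 a.out
    rw [quotVert_out] at h
    simp only [Pi.one_apply, mul_one, Finset.sum_const, nsmul_eq_mul,
      card_sphere_one hT.connected hd] at h
    rw [h, sub_add_cancel, sub_add_cancel]
    cases c a.out <;> cases i <;> rfl
  balance a b := vertMass_mul_vertKernel Γ hT.connected (neighborSet_finite hd) a b
  col_ne a b h := by
    classical
    rw [vertKernel, Nat.cast_ne_zero, Finset.card_ne_zero] at h
    obtain ⟨w, hw⟩ := h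
    rw [Finset.mem_filter, SimpleGraph.mem_sphere_one hT.connected (neighborSet_finite hd)] at hw
    have h1 := c.valid hw.1
    rw [← hw.2, color_out]
    revert h1
    cases c a.out <;> cases c w <;> cases i <;> simp
  two_le_p := by
    have : (3 : ℝ) ≤ d i := by exact_mod_cast hd3 i
    linarith
  two_le_q := by
    have : (3 : ℝ) ≤ d (!i) := by exact_mod_cast hd3 (!i)
    linarith

variable (hT : T.IsTree) (c : T.Coloring Bool) {d : Bool → ℕ}
    (hd : ∀ v, (T.neighborSet v).encard = d (c v)) (hd3 : ∀ i, 3 ≤ d i)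
    (Γ : Subgroup (TreeAut T)) [∀ v : V, Finite (MulAction.stabilizer Γ v)]
    (hs : Summable (vertMass Γ)) (i : Bool)

theorem quotKernel_op_apply (f : (quotKernel hT c hd hd3 Γ hs i).Fun) (v : V) :
    ((quotKernel hT c hd hd3 Γ hs i).op f) (quotVert Γ v) =
      ∑ w ∈ T.sphere v 1, f (quotVert Γ w) :=
  tsum_vertKernel_mul Γ hT.connected (neighborSet_finite hd) f v

/-- Lifted to T, the operators defined by the recurrence are the actual sums over spheres. The
colour condition matters: the roles of p and q are exchanged on the other class. -/
theorem quotKernel_sphereOp_apply : ∀ (f : (quotKernel hT c hd hd3 Γ hs i).Fun) (k : ℕ) (v : V),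
    c v = i → ((quotKernel hT c hd hd3 Γ hs i).sphereOp k f) (quotVert Γ v) =
      ∑ w ∈ T.sphere v (2 * k), f (quotVert Γ w) := by
  have hc := hT.connected
  have hfin := neighborSet_finite hd
  have hcard := card_sphere_one hc hd
  set K := quotKernel hT c hd hd3 Γ hs i with hK
  intro f k
  have hcol : ∀ v, c v = i → ∀ u ∈ T.sphere v 1, c u = !i := by
    intro v hv u hu
    have := c.valid ((SimpleGraph.mem_sphere_one hc hfin).1 hu)
    rw [hv] at this
    revert this
    cases i <;> cases c u <;> simp
  have hcol' : ∀ v, c v = i → ∀ u ∈ T.sphere v 1, ∀ w ∈ T.sphere u 1, c w = i := by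
    intro v hv u hu w hw
    have := c.valid ((SimpleGraph.mem_sphere_one hc hfin).1 hw)
    rw [hcol v hv u hu] at this
    revert this
    cases i <;> cases c w <;> simp
  -- Two applications of `sum_sphere_sphere`: around the neighbours of `v`, where the radius is odd
  -- and the correction is always q, and then around `v`, where radius zero is exceptional.
  have step : ∀ (g : K.Fun) (k : ℕ),
      (∀ v, c v = i → g (quotVert Γ v) = ∑ w ∈ T.sphere v (2 * k + 2), f (quotVert Γ w)) →
      ∀ v, c v = i → (K.op (K.op g)) (quotVert Γ v) =
        ∑ w ∈ T.sphere v (2 * k + 4), f (quotVert Γ w) +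
        (K.p + K.q) * ∑ w ∈ T.sphere v (2 * k + 2), f (quotVert Γ w) +
        K.q * (K.p + 1 - if 2 * k = 0 then 0 else 1) *
          ∑ w ∈ T.sphere v (2 * k), f (quotVert Γ w) := by
    intro g k hg v hv
    have hp : (d i : ℝ) = K.p + 1 := (sub_add_cancel _ _).symm
    have hq : (d (!i) : ℝ) = K.q + 1 := (sub_add_cancel _ _).symm
    have h1 : ∀ u ∈ T.sphere v 1, (K.op g) (quotVert Γ u) =
        ∑ w ∈ T.sphere u (2 * k + 3), f (quotVert Γ w) +
          K.q * ∑ w ∈ T.sphere u (2 * k + 1), f (quotVert Γ w) := by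
      intro u hu
      rw [quotKernel_op_apply, Finset.sum_congr rfl fun w hw => hg w (hcol' v hv u hu w hw)]
      have := SimpleGraph.sum_sphere_sphere hT hfin (fun w => f (quotVert Γ w)) u (2 * k + 1)
      rw [hcard, hcol v hv u hu, hq, if_neg (by omega), add_sub_cancel_right] at this
      exact this
    rw [quotKernel_op_apply, Finset.sum_congr rfl h1, Finset.sum_add_distrib, ← Finset.mul_sum]
    have h2 := SimpleGraph.sum_sphere_sphere hT hfin (fun w => f (quotVert Γ w)) v (2 * k + 2)
    have h3 := SimpleGraph.sum_sphere_sphere hT hfin (fun w => f (quotVert Γ w)) v (2 * k)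
    rw [hcard, hv, hp] at h2 h3
    rw [if_neg (by omega)] at h2
    rw [show 2 * k + 3 = 2 * k + 2 + 1 by ring, h2, h3]
    ring
  have h0 : ∀ v, c v = i → f (quotVert Γ v) = ∑ w ∈ T.sphere v 0, f (quotVert Γ w) := by
    intro v _
    rw [SimpleGraph.sphere_zero hc hfin, Finset.sum_singleton]
  have h1 : ∀ v, c v = i → (K.sphereOp 1 f) (quotVert Γ v) =
      ∑ w ∈ T.sphere v 2, f (quotVert Γ w) := by
    intro v hv
    change (K.op (K.op f)) (quotVert Γ v) - (K.p + 1) * f (quotVert Γ v) = _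
    have hp : (d i : ℝ) = K.p + 1 := (sub_add_cancel _ _).symm
    have h2 := SimpleGraph.sum_sphere_sphere hT hfin (fun w => f (quotVert Γ w)) v 0
    rw [hcard, hv, hp, if_pos rfl, sub_zero, ← h0 v hv] at h2
    rw [quotKernel_op_apply, Finset.sum_congr rfl fun u _ => quotKernel_op_apply hT c hd hd3 Γ hs i f u]
    linarith
  induction k using Nat.strong_induction_on with
  | _ k ih =>
    match k, ih with
    | 0, _ => exact h0
    | 1, _ => exact h1
    | 2, _ =>
      intro v hv
      change (K.op (K.op (K.sphereOp 1 f))) (quotVert Γ v) -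
        (K.p + K.q) * (K.sphereOp 1 f) (quotVert Γ v) - (K.q * (K.p + 1)) * f (quotVert Γ v) = _
      rw [step _ 0 h1 v hv, h1 v hv, h0 v hv]
      simp
      ring
    | k + 3, ih =>
      intro v hv
      change (K.op (K.op (K.sphereOp (k + 2) f))) (quotVert Γ v) -
        (K.p + K.q) * (K.sphereOp (k + 2) f) (quotVert Γ v) -
        (K.p * K.q) * (K.sphereOp (k + 1) f) (quotVert Γ v) = _
      rw [step _ (k + 1) (ih (k + 2) (by omega)) v hv, ih (k + 2) (by omega) v hv,
        ih (k + 1) (by omega) v hv, if_neg (by omega)]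
      rw [show 2 * (k + 3) = 2 * (k + 1) + 4 by ring, show 2 * (k + 2) = 2 * (k + 1) + 2 by ring]
      ring

open Classical in
/-- The total mass of the vertices of `Γ \ T` that lift to vertices of colour `i`. -/
noncomputable def colorMass (i : Bool) : ℝ :=
  ∑' a : QuotVert Γ, if c a.out = i then vertMass Γ a else 0

theorem quotKernel_int_even :
    (quotKernel hT c hd hd3 Γ hs i).int (quotKernel hT c hd hd3 Γ hs i).even =
      colorMass c Γ i := by
  classical
  rw [BipartiteKernel.int_apply, colorMass]
  refine tsum_congr fun a => ?_
  change vertMass Γ a * (bif c a.out == i then 1 else 0) = _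
  by_cases h : c a.out = i
  · simp [h]
  · rw [beq_eq_false_iff_ne.2 h, if_neg h, cond_false, mul_zero]

-- The equidistribution estimate, read in T: the sphere operator applied to the point mass counts
-- orbit points, and applied to the indicator of the colour class it gives the size of the sphere.
open Classical in
theorem exists_abs_card_orbit_sub_le (hP : (quotKernel hT c hd hd3 Γ hs i).Poincare) {o : V}
    (ho : c o = i) : ∃ r C : ℝ, 0 < r ∧ r < (d i - 1) * (d (!i) - 1) ∧ 0 ≤ C ∧ ∀ k : ℕ,
      |(((T.sphere o (2 * k)).filter fun w => quotVert Γ w = quotVert Γ o).card : ℝ) -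
        vertMass Γ (quotVert Γ o) / colorMass c Γ i * (T.sphere o (2 * k)).card| ≤
          C * (k + 1) * r ^ k := by
  have hc := hT.connected
  have hfin := neighborSet_finite hd
  have hcol : ∀ v, (quotKernel hT c hd hd3 Γ hs i).col (quotVert Γ v) = (c v == i) := by
    intro v
    change (c (quotVert Γ v).out == i) = _
    rw [color_out]
  obtain ⟨r, C, hr, hr', hC, h⟩ := BipartiteKernel.abs_sphereOp_sub_le hP (o := quotVert Γ o)
    (by rw [hcol, ho]; simp)
  refine ⟨r, C, hr, hr', hC, fun k => ?_⟩
  have hk := h k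
  rw [quotKernel_int_even, quotKernel_sphereOp_apply hT c hd hd3 Γ hs i _ k o ho,
    quotKernel_sphereOp_apply hT c hd hd3 Γ hs i _ k o ho] at hk
  have e1 : ∑ w ∈ T.sphere o (2 * k),
      ((quotKernel hT c hd hd3 Γ hs i).delta (quotVert Γ o)) (quotVert Γ w) =
      (((T.sphere o (2 * k)).filter fun w => quotVert Γ w = quotVert Γ o).card : ℝ) := by
    rw [Finset.card_filter, Nat.cast_sum]
    refine Finset.sum_congr rfl fun w _ => ?_
    simp only [BipartiteKernel.delta, BipartiteKernel.mkFun_apply]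
    split_ifs <;> simp
  have e2 : ∑ w ∈ T.sphere o (2 * k), (quotKernel hT c hd hd3 Γ hs i).even (quotVert Γ w) =
      ((T.sphere o (2 * k)).card : ℝ) := by
    rw [Finset.card_eq_sum_ones, Nat.cast_sum]
    refine Finset.sum_congr rfl fun w hw => ?_
    rw [SimpleGraph.mem_sphere hc hfin] at hw
    have : c w = i := by
      rw [← ho, eq_comm, color_eq_iff_even_dist hT c, hw]
      exact even_two_mul k
    change (bif (quotKernel hT c hd hd3 Γ hs i).col (quotVert Γ w) then (1 : ℝ) else 0) = _
    rw [hcol, this]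
    simp
  rw [e1, e2] at hk
  exact hk

theorem summable_vertMass_of_isGeometricallyFinite {V : Type*} {T : SimpleGraph V}
    (hT : T.IsTree) {c : T.Coloring Bool} {d : Bool → ℕ}
    (hd : ∀ v, (T.neighborSet v).encard = d (c v)) (hd3 : ∀ i, 3 ≤ d i)
    (Γ : Subgroup (TreeAut T)) [∀ v : V, Finite (MulAction.stabilizer Γ v)]
    (hgf : (quotGraph Γ).IsGeometricallyFinite) :
    Summable (vertMass Γ) := by
  obtain ⟨FV, FE, N, x, e, hFV, -, -, hray, -, hinj, hmem, -⟩ := hgf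
  have h3 : ∀ v, 3 ≤ (T.sphere v 1).card := fun v => by
    rw [card_sphere_one hT.connected hd]
    exact hd3 _
  refine summable_of_rays hFV.toFinset (fun i k => x i (k + 1)) ?_
    (fun a => (vertMass_pos Γ a).le) ?_
  · intro v hv
    rw [Set.Finite.mem_toFinset] at hv
    exact (hmem v).1 hv
  · intro i k
    exact two_mul_vertMass_le_of_isNagaoRay Γ hT.connected (neighborSet_finite hd) h3 (hray i) k

theorem poincare_of_isGeometricallyFinite (hgf : (quotGraph Γ).IsGeometricallyFinite) :
    (quotKernel hT c hd hd3 Γ hs i).Poincare := by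
  obtain ⟨FV, FE, N, x, e, hFV, -, -, hray, -, hinj, hmem, -⟩ := hgf
  have hc := hT.connected
  have hfin := neighborSet_finite hd
  have h3 : ∀ v, 3 ≤ (T.sphere v 1).card := fun v => by
    rw [card_sphere_one hc hd]
    exact hd3 _
  obtain ⟨o⟩ := hc.nonempty
  refine BipartiteKernel.poincare_of_rays (quotVert Γ o) ?_ hFV.toFinset
    (fun i k => x i (k + 1)) ?_ ?_ ?_ ?_
  · intro a
    rw [← quotVert_out Γ a]
    generalize a.out = v
    obtain ⟨w⟩ := hc o v
    induction w with
    | nil => exact Relation.ReflTransGen.refl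
    | cons h _ ih =>
      exact Relation.ReflTransGen.head (lt_of_lt_of_le one_pos (one_le_vertKernel Γ hc hfin h)) ih
  · intro v hv
    rw [Set.Finite.mem_toFinset] at hv
    exact (hmem v).1 hv
  · intro i k l hkl
    exact congrArg Prod.snd (@hinj (i, k) (i, l) hkl)
  · intro i k
    exact two_mul_vertMass_le_of_isNagaoRay Γ hc hfin h3 (hray i) k
  · intro i k
    exact one_le_vertKernel_of_isNagaoRay Γ hc hfin (hray i) (k + 1)

end QuotKernel

/-! ### The topological group of automorphisms of a tree -/

section Topology

variable {V : Type*} {T : SimpleGraph V}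

theorem continuous_treeAut_iff {X : Type*} [TopologicalSpace X] {f : X → TreeAut T} :
    Continuous f ↔ ∀ v w : V, IsOpen {x | f x • v = w} := by
  refine ⟨fun h v w => (isOpen_setOf_smul_eq v w).preimage h, fun h => ?_⟩
  let _ : TopologicalSpace V := ⊥
  have : DiscreteTopology V := ⟨rfl⟩
  refine continuous_induced_rng.2 (continuous_induced_rng.2 (continuous_pi fun v => ?_))
  refine continuous_discrete_rng.2 fun w => ?_
  exact h v w

instance : IsTopologicalGroup (TreeAut T) where
  continuous_mul := by
    refine continuous_treeAut_iff.2 fun v w => ?_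
    have : {x : TreeAut T × TreeAut T | (x.1 * x.2) • v = w} =
        ⋃ u, {g : TreeAut T | g • u = w} ×ˢ {h : TreeAut T | h • v = u} := by
      ext ⟨g, h⟩
      simp [mul_smul]
    rw [this]
    exact isOpen_iUnion fun u => (isOpen_setOf_smul_eq u w).prod (isOpen_setOf_smul_eq v u)
  continuous_inv := by
    refine continuous_treeAut_iff.2 fun v w => ?_
    have : {g : TreeAut T | g⁻¹ • v = w} = {g : TreeAut T | g • w = v} := by
      ext g
      rw [Set.mem_ofPred_eq, Set.mem_ofPred_eq, inv_smul_eq_iff, eq_comm]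
    rw [this]
    exact isOpen_setOf_smul_eq w v

/-- Under the stabilizer of `o` each vertex moves in a finite sphere, so along an ultrafilter g • v
and g⁻¹ • v are eventually constant. The two limits are mutually inverse automorphisms; both are
needed, as a pointwise limit of bijections could fail to be surjective in general. -/
theorem isCompact_stabilizer (hT : T.IsTree) (hfin : ∀ v, (T.neighborSet v).Finite) (o : V) :
    IsCompact (MulAction.stabilizer (TreeAut T) o : Set (TreeAut T)) := by
  have hc := hT.connected
  have c : T.Coloring Bool := hT.isBipartite.toColoring (by simp)
  rw [isCompact_iff_ultrafilter_le_nhds]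
  intro 𝒰 h𝒰
  rw [le_principal_iff] at h𝒰
  have key : ∀ f : TreeAut T → V, (∃ s : Finset V,
      ∀ g ∈ MulAction.stabilizer (TreeAut T) o, f g ∈ s) → ∃ w, ∀ᶠ g in 𝒰, f g = w := by
    rintro f ⟨s, hs⟩
    have h1 : (s : Set V) ∈ 𝒰.map f := by
      rw [Ultrafilter.mem_map]
      exact mem_of_superset h𝒰 hs
    obtain ⟨w, -, hw⟩ := Ultrafilter.eq_pure_of_finite_mem s.finite_toSet h1
    refine ⟨w, ?_⟩
    have : {w} ∈ 𝒰.map f := by rw [hw]; exact Ultrafilter.mem_pure.2 rfl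
    exact this
  have hsph : ∀ v, ∀ g ∈ MulAction.stabilizer (TreeAut T) o, g • v ∈ T.sphere o (T.dist o v) := by
    intro v g hg
    rw [SimpleGraph.mem_sphere hc hfin]
    have := dist_smul_smul hc g o v
    rwa [MulAction.mem_stabilizer_iff.1 hg] at this
  choose φ hφ using fun v => key (fun g => g • v) ⟨_, hsph v⟩
  choose ψ hψ using fun v => key (fun g => g⁻¹ • v)
    ⟨_, fun g hg => hsph v _ (inv_mem hg)⟩
  let e : T ≃g T :=
    { toFun := φ
      invFun := ψ
      left_inv := fun v => by
        obtain ⟨g, h1, h2⟩ := ((hφ v).and (hψ (φ v))).exists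
        rw [← h2, ← h1, inv_smul_smul]
      right_inv := fun v => by
        obtain ⟨g, h1, h2⟩ := ((hψ v).and (hφ (ψ v))).exists
        rw [← h2, ← h1, smul_inv_smul]
      map_rel_iff' := fun {u v} => by
        obtain ⟨g, h1, h2⟩ := ((hφ u).and (hφ v)).exists
        change T.Adj (φ u) (φ v) ↔ _
        rw [← h1, ← h2]
        exact adj_smul_iff g }
  have he : e ∈ evenAut T := by
    intro v
    obtain ⟨p⟩ := hc (e v) v
    refine ⟨p, (c.even_length_iff_congr p).2 ?_⟩
    obtain ⟨g, h1⟩ := (hφ v).exists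
    change c (φ v) = true ↔ _
    rw [← h1, color_smul]
  refine ⟨⟨e, he⟩, ?_, ?_⟩
  · obtain ⟨g, h1, h2⟩ := ((hφ o).and h𝒰).exists
    exact h1.symm.trans h2
  · rw [le_nhds_iff]
    intro O hO hOo
    obtain ⟨F, hF⟩ := exists_finset_of_isOpen hOo hO
    have : ∀ᶠ g in (𝒰 : Filter (TreeAut T)), ∀ v ∈ F, g • v = φ v := by
      rw [Filter.eventually_all_finset]
      exact fun v _ => hφ v
    exact mem_of_superset this fun g hg => hF g hg

theorem isOpen_stabilizer (o : V) :
    IsOpen (MulAction.stabilizer (TreeAut T) o : Set (TreeAut T)) := isOpen_setOf_smul_eq o o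

theorem locallyCompactSpace_treeAut (hT : T.IsTree) (hfin : ∀ v, (T.neighborSet v).Finite) :
    LocallyCompactSpace (TreeAut T) := by
  obtain ⟨o⟩ := hT.connected.nonempty
  exact (isCompact_stabilizer hT hfin o).locallyCompactSpace_of_mem_nhds_of_group
    ((isOpen_stabilizer o).mem_nhds (one_mem (MulAction.stabilizer (TreeAut T) o)))

theorem countable_vertices (hT : T.Connected) (hfin : ∀ v, (T.neighborSet v).Finite) :
    Countable V := by
  obtain ⟨o⟩ := hT.nonempty
  have : (Set.univ : Set V) ⊆ ⋃ n, {w | T.dist o w = n} := fun w _ => by simp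
  rw [← Set.countable_univ_iff]
  exact (Set.countable_iUnion fun n => (SimpleGraph.finite_sphere hT hfin o n).countable).mono this

theorem secondCountableTopology_treeAut [Countable V] :
    SecondCountableTopology (TreeAut T) := by
  let _ : TopologicalSpace V := ⊥
  have : DiscreteTopology V := ⟨rfl⟩
  have h : IsInducing fun g : T ≃g T => (g : V → V) := ⟨rfl⟩
  have : SecondCountableTopology (T ≃g T) := h.secondCountableTopology
  exact inferInstanceAs (SecondCountableTopology (evenAut T : Set (T ≃g T)))

/-- The group of automorphisms of a biregular tree is unimodular. -/
theorem isMulRightInvariant_treeAut (hT : T.IsTree) (c : T.Coloring Bool) {d : Bool → ℕ}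
    (hd : ∀ v, (T.neighborSet v).encard = d (c v)) (m : Measure (TreeAut T)) [m.IsHaarMeasure] :
    m.IsMulRightInvariant := by
  have hfin := neighborSet_finite hd
  have := locallyCompactSpace_treeAut hT hfin
  have := countable_vertices hT.connected hfin
  have := secondCountableTopology_treeAut (T := T)
  obtain ⟨o⟩ := hT.connected.nonempty
  have hm0 : m (MulAction.stabilizer (TreeAut T) o) ≠ 0 :=
    ((isOpen_stabilizer o).measure_pos m ⟨1, one_mem (MulAction.stabilizer (TreeAut T) o)⟩).ne'
  have hm1 : m (MulAction.stabilizer (TreeAut T) o) ≠ ∞ :=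
    (isCompact_stabilizer hT hfin o).measure_lt_top.ne
  have hmap : ∀ g, Measure.map (· * g) m = Measure.modularCharacter g • m := fun g =>
    Measure.map_right_mul_eq_modularCharacterFun_smul m g
  -- Right translation by `k` preserves the stabilizer of `o`, whose measure is positive and finite.
  have hstab : ∀ k ∈ MulAction.stabilizer (TreeAut T) o,
      Measure.modularCharacter k = 1 := by
    intro k hk
    have h : Measure.map (· * k) m (MulAction.stabilizer (TreeAut T) o : Set (TreeAut T)) =
        (Measure.modularCharacter k • m) (MulAction.stabilizer (TreeAut T) o) := by rw [hmap k]
    rw [Measure.map_apply (measurable_mul_const k) (isOpen_stabilizer o).measurableSet] at h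
    have e : (fun x => x * k) ⁻¹' (MulAction.stabilizer (TreeAut T) o : Set (TreeAut T)) =
        (MulAction.stabilizer (TreeAut T) o : Set (TreeAut T)) := by
      ext x
      exact Subgroup.mul_mem_cancel_right _ hk
    rw [e, Measure.smul_apply, ENNReal.smul_def, smul_eq_mul] at h
    have h2 : (Measure.modularCharacter k : ℝ≥0∞) = 1 := by
      refine (ENNReal.mul_left_inj hm0 hm1).1 ?_
      rw [one_mul, ← h]
    exact_mod_cast h2
  have hone : ∀ g : TreeAut T, Measure.modularCharacter g = 1 := by
    intro g
    -- Some σ exchanges `o` and `g • o`. Its square fixes `o`, so the modular character of σ is a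
    -- nonnegative square root of 1; and σ⁻¹g fixes `o`.
    obtain ⟨σ, h1, h2⟩ := exists_treeAut_smul_eq hT c hd (o := o) (o' := g • o) (x := g • o)
      (x' := o) (color_smul c g o).symm SimpleGraph.dist_comm
    have h3 : Measure.modularCharacter σ = 1 := by
      have := hstab (σ * σ) (by rw [MulAction.mem_stabilizer_iff, mul_smul, h1, h2])
      rw [map_mul, ← sq] at this
      exact (pow_eq_one_iff_of_nonneg zero_le two_ne_zero).1 this
    have h4 := hstab (σ⁻¹ * g) (by
      rw [MulAction.mem_stabilizer_iff, mul_smul, ← h1, inv_smul_smul])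
    rw [map_mul, map_inv, h3] at h4
    simpa using h4
  refine ⟨fun g => ?_⟩
  rw [hmap, hone, one_smul]

/-- The set is a right translate of the stabilizer of `o`, hence unimodularity is needed. -/
theorem measure_setOf_smul_eq (hT : T.IsTree) (c : T.Coloring Bool) {d : Bool → ℕ}
    (hd : ∀ v, (T.neighborSet v).encard = d (c v)) (m : Measure (TreeAut T)) [m.IsHaarMeasure]
    {o w : V} (hw : c w = c o) :
    m {h : TreeAut T | h • w = o} = m (MulAction.stabilizer (TreeAut T) o) := by
  have := isMulRightInvariant_treeAut hT c hd m
  obtain ⟨g, hg, -⟩ := exists_treeAut_smul_eq hT c hd (o := o) (o' := w) (x := o) (x' := w)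
    hw.symm (by simp)
  rw [← measure_preimage_mul_right m g⁻¹ {h : TreeAut T | h • w = o}]
  congr 1
  ext x
  change (x * g⁻¹) • w = o ↔ x • o = o
  rw [mul_smul, ← hg, inv_smul_smul]

theorem measure_setOf_smul_eq_zero (c : T.Coloring Bool) (m : Measure (TreeAut T)) {o w : V}
    (hw : c w ≠ c o) : m {h : TreeAut T | h • w = o} = 0 := by
  have : {h : TreeAut T | h • w = o} = ∅ := by
    refine Set.eq_empty_of_forall_notMem fun h hh => hw ?_
    rw [← color_smul c h w, show h • w = o from hh]
  rw [this, measure_empty]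

theorem countable_of_finite_stabilizer {G X : Type*} [Group G] [MulAction G X] [Countable X]
    (x : X) [Finite (MulAction.stabilizer G x)] : Countable G := by
  have : Countable (G ⧸ MulAction.stabilizer G x) :=
    (MulAction.orbitEquivQuotientStabilizer G x).symm.injective.countable
  exact (Subgroup.groupEquivQuotientProdSubgroup (s := MulAction.stabilizer G x)).injective.countable

/-- The covolume of a discrete subgroup of the automorphism group of a biregular tree. -/
theorem measure_fundamentalDomain (hT : T.IsTree) (c : T.Coloring Bool) {d : Bool → ℕ}
    (hd : ∀ v, (T.neighborSet v).encard = d (c v)) (m : Measure (TreeAut T)) [m.IsHaarMeasure]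
    (Γ : Subgroup (TreeAut T)) [∀ v : V, Finite (MulAction.stabilizer Γ v)]
    (hs : Summable (vertMass Γ)) (o : V) {D : Set (TreeAut T)}
    (hD : IsFundamentalDomain Γ.op D m) (hDm : MeasurableSet D) :
    m D = m (MulAction.stabilizer (TreeAut T) o) * ENNReal.ofReal (colorMass c Γ (c o)) := by
  classical
  have := isMulRightInvariant_treeAut hT c hd m
  have := countable_vertices hT.connected (neighborSet_finite hd)
  have : Countable Γ := countable_of_finite_stabilizer o
  have : Countable Γ.op := Γ.equivOp.symm.injective.countable
  -- The sets `S w` partition the group according to the point h⁻¹ • o. Summing m (S w ∩ D) over a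
  -- Γ-orbit of vertices gives back m (S w), up to the order of the stabilizer.
  let S : V → Set (TreeAut T) := fun w => {h | h • w = o}
  have hSm : ∀ w, MeasurableSet (S w) := fun w => (isOpen_setOf_smul_eq w o).measurableSet
  have h1 : m D = ∑' w, m (S w ∩ D) := by
    rw [← measure_iUnion]
    · congr 1
      ext h
      rw [Set.mem_iUnion]
      exact ⟨fun hh => ⟨h⁻¹ • o, smul_inv_smul h o, hh⟩, fun ⟨_, hh⟩ => hh.2⟩
    · intro w w' hww'
      refine Set.disjoint_left.2 fun h hh hh' => hww' ?_
      have e1 : h • w = o := hh.1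
      have e2 : h • w' = o := hh'.1
      exact MulAction.injective h (e1.trans e2.symm)
    · exact fun w => (hSm w).inter hDm
  have h2 : ∀ w, m (S w) = ∑' γ : Γ, m (S (γ • w) ∩ D) := by
    intro w
    -- Right multiplication by γ⁻¹ carries `S w` to `S (γ • w)`, whence the reindexing by inversion.
    rw [hD.measure_eq_tsum (S w), ← ((Equiv.inv Γ).trans Γ.equivOp).tsum_eq]
    refine tsum_congr fun γ => ?_
    congr 2
    ext h
    rw [Set.mem_smul_set_iff_inv_smul_mem]
    change (h * (γ.1⁻¹)⁻¹) • w = o ↔ h • (γ.1 • w) = o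
    rw [inv_inv, mul_smul]
  rw [h1, tsum_eq_tsum_orbitMass (G := Γ), colorMass, ENNReal.ofReal_tsum_of_nonneg,
    ← ENNReal.tsum_mul_left]
  · refine tsum_congr fun a => ?_
    rw [← h2]
    split_ifs with h
    · rw [measure_setOf_smul_eq hT c hd m h, orbitMass_eq_ofReal, mul_comm]
    · rw [measure_setOf_smul_eq_zero c m h, ENNReal.ofReal_zero, mul_zero, mul_zero]
  · intro a
    split_ifs
    exacts [(vertMass_pos Γ a).le, le_rfl]
  · refine Summable.of_nonneg_of_le (fun a => ?_) (fun a => ?_) hs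
    · split_ifs
      exacts [(vertMass_pos Γ a).le, le_rfl]
    · split_ifs
      exacts [le_rfl, (vertMass_pos Γ a).le]

end Topology

/-! ### Counting -/

section Counting

variable {V : Type*} {T : SimpleGraph V}

theorem card_smul_mem {G X : Type*} [Group G] [MulAction G X] [∀ x : X, Finite (MulAction.stabilizer G x)]
    (x : X) (s : Finset X) (hs : ∀ y ∈ s, y ∈ MulAction.orbit G x) :
    {g : G | g • x ∈ s}.ncard = Nat.card (MulAction.stabilizer G x) * s.card := by
  classical
  have h := tsum_smul_eq_card_mul (G := G) x (fun y => if y ∈ s then 1 else 0)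
  have h1 : ∑' g : G, (if g • x ∈ s then (1 : ℝ≥0∞) else 0) = {g : G | g • x ∈ s}.encard := by
    rw [← ENNReal.tsum_set_one, tsum_subtype {g : G | g • x ∈ s} (fun _ => (1 : ℝ≥0∞))]
    refine tsum_congr fun g => ?_
    simp [Set.indicator_apply]
  have h2 : ∑' y : MulAction.orbit G x, (if (y : X) ∈ s then (1 : ℝ≥0∞) else 0) = s.card := by
    rw [tsum_subtype (MulAction.orbit G x) (fun y => if y ∈ s then (1 : ℝ≥0∞) else 0),
      tsum_eq_sum (s := s)]
    · rw [Finset.card_eq_sum_ones, Nat.cast_sum]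
      refine Finset.sum_congr rfl fun y hy => ?_
      rw [Set.indicator_of_mem (hs y hy), if_pos hy, Nat.cast_one]
    · intro y hy
      rw [Set.indicator_apply_eq_zero]
      exact fun _ => if_neg hy
  rw [h1, h2, ENat.card_eq_coe_natCard] at h
  have h3 : {g : G | g • x ∈ s}.encard =
      ((Nat.card (MulAction.stabilizer G x) * s.card : ℕ) : ℕ∞) := by
    have : ((({g : G | g • x ∈ s}.encard : ℕ∞)) : ℝ≥0∞) =
        (((Nat.card (MulAction.stabilizer G x) * s.card : ℕ) : ℕ∞) : ℝ≥0∞) := by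
      rw [h]
      push_cast
      rfl
    exact_mod_cast this
  rw [Set.ncard_def, h3]
  rfl

theorem evenBallCard_eq_sum (hT : T.Connected) (hfin : ∀ v, (T.neighborSet v).Finite) (o : V)
    (R : ℕ) : evenBallCard T o (2 * R) = ∑ k ∈ Finset.range (R + 1), (T.sphere o (2 * k)).card := by
  classical
  rw [← Finset.card_biUnion, evenBallCard, ← Set.ncard_coe_finset]
  · congr 1
    ext v
    rw [Finset.mem_coe, Finset.mem_biUnion, Set.mem_ofPred_eq]
    constructor
    · rintro ⟨⟨k, hk⟩, h⟩
      refine ⟨k, Finset.mem_range.2 (by omega), ?_⟩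
      rw [SimpleGraph.mem_sphere hT hfin, SimpleGraph.dist_comm]
      omega
    · rintro ⟨k, hk, h⟩
      rw [SimpleGraph.mem_sphere hT hfin, SimpleGraph.dist_comm] at h
      rw [Finset.mem_range] at hk
      exact ⟨by rw [h]; exact even_two_mul k, by omega⟩
  · intro k _ l _ hkl
    refine Finset.disjoint_left.2 fun v h1 h2 => hkl ?_
    rw [SimpleGraph.mem_sphere hT hfin] at h1 h2
    omega

-- Elements of Γ move `o` by an even distance, and each point of the orbit is reached by as many
-- elements as the stabilizer of `o` has.
open Classical in
theorem latticeCount_eq_sum (hT : T.IsTree) (hfin : ∀ v, (T.neighborSet v).Finite)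
    (Γ : Subgroup (TreeAut T)) [∀ v : V, Finite (MulAction.stabilizer Γ v)] (o : V) (R : ℕ) :
    latticeCount Γ o (2 * R) = Nat.card (MulAction.stabilizer Γ o) *
      ∑ k ∈ Finset.range (R + 1),
        ((T.sphere o (2 * k)).filter fun w => quotVert Γ w = quotVert Γ o).card := by
  have hc := hT.connected
  rw [← Finset.card_biUnion, ← card_smul_mem, latticeCount]
  · rw [← Set.ncard_image_of_injective _ (Subtype.val_injective (p := (· ∈ Γ)))]
    congr 1
    ext g
    rw [Set.mem_ofPred_eq, Set.mem_image]
    constructor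
    · rintro ⟨hg, h⟩
      refine ⟨⟨g, hg⟩, ?_, rfl⟩
      rw [Set.mem_ofPred_eq, Finset.mem_biUnion]
      obtain ⟨k, hk⟩ := (mem_evenAut_iff hT g.1).1 g.2 o
      change T.dist (g • o) o = _ at hk
      refine ⟨k, Finset.mem_range.2 (by omega), ?_⟩
      rw [Finset.mem_filter, SimpleGraph.mem_sphere hc hfin, SimpleGraph.dist_comm]
      refine ⟨?_, quotVert_smul Γ ⟨g, hg⟩ o⟩
      change T.dist (g • o) o = _
      omega
    · rintro ⟨γ, h, rfl⟩
      rw [Set.mem_ofPred_eq, Finset.mem_biUnion] at h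
      obtain ⟨k, hk, h⟩ := h
      rw [Finset.mem_filter, SimpleGraph.mem_sphere hc hfin, SimpleGraph.dist_comm] at h
      rw [Finset.mem_range] at hk
      refine ⟨γ.2, ?_⟩
      have h1 : T.dist (γ.1 • o) o = 2 * k := h.1
      omega
  · intro y hy
    rw [Finset.mem_biUnion] at hy
    obtain ⟨k, -, hy⟩ := hy
    exact (quotVert_eq_iff Γ).1 (Finset.mem_filter.1 hy).2
  · intro k _ l _ hkl
    refine Finset.disjoint_left.2 fun v h1 h2 => hkl ?_
    rw [Finset.mem_filter, SimpleGraph.mem_sphere hc hfin] at h1 h2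
    omega

/-- The polynomial factor is absorbed by enlarging the base θ to (1 + θ)/2; the square root accounts
for the exponent 2R. -/
theorem exists_isLittleO_pow {f : ℕ → ℝ} {C θ : ℝ} (h0 : 0 ≤ θ) (h1 : θ < 1)
    (hf : ∀ R : ℕ, |f R| ≤ C * ((R + 1) ^ 2 * θ ^ R)) :
    ∃ c : ℝ, 0 < c ∧ c < 1 ∧ f =o[atTop] fun R : ℕ => c ^ (2 * R) := by
  refine ⟨√((1 + θ) / 2), by positivity, ?_, ?_⟩
  · rw [Real.sqrt_lt' one_pos]
    linarith
  have e : (fun R : ℕ => √((1 + θ) / 2) ^ (2 * R)) = fun R : ℕ => ((1 + θ) / 2) ^ R := by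
    funext R
    rw [pow_mul, Real.sq_sqrt (by positivity)]
  rw [e]
  have hlit : (fun R : ℕ => (R : ℝ) ^ 2 * θ ^ R) =o[atTop] fun R : ℕ => ((1 + θ) / 2) ^ R :=
    isLittleO_pow_const_mul_const_pow_const_pow_of_norm_lt 2
      (by rw [Real.norm_eq_abs, abs_of_nonneg h0]; linarith)
  refine IsBigO.trans_isLittleO ?_ hlit
  refine IsBigO.of_bound (|C| * 4) ?_
  filter_upwards [eventually_ge_atTop 1] with R hR
  have hR' : (1 : ℝ) ≤ R := by exact_mod_cast hR
  rw [Real.norm_eq_abs, Real.norm_eq_abs, abs_of_nonneg (by positivity : 0 ≤ (R : ℝ) ^ 2 * θ ^ R)]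
  calc |f R| ≤ C * ((R + 1) ^ 2 * θ ^ R) := hf R
    _ ≤ |C| * ((R + 1) ^ 2 * θ ^ R) :=
      mul_le_mul_of_nonneg_right (le_abs_self C) (by positivity)
    _ ≤ |C| * ((2 * R) ^ 2 * θ ^ R) := by
      gcongr
      linarith
    _ = |C| * 4 * (R ^ 2 * θ ^ R) := by ring

/-- The R + 1 errors are bounded by the largest possible one, and the denominator by its last term.
Replacing r by max(r, 1) makes its powers monotone. -/
theorem abs_div_sub_le {g C r m μ : ℝ} {a b : ℕ → ℝ} (hg : 0 ≤ g) (hC : 0 ≤ C) (hr : 0 < r)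
    (hm : 1 < m) (hb : ∀ k, m ^ k ≤ b k) (h : ∀ k : ℕ, |a k - μ * b k| ≤ C * (k + 1) * r ^ k)
    (R : ℕ) :
    |(g * ∑ k ∈ Finset.range (R + 1), a k) / (∑ k ∈ Finset.range (R + 1), b k) - g * μ| ≤
      g * C * ((R + 1) ^ 2 * (max r 1 / m) ^ R) := by
  set B := ∑ k ∈ Finset.range (R + 1), b k with hB
  have hm0 : 0 < m := by linarith
  have hBm : m ^ R ≤ B := by
    refine (hb R).trans (Finset.single_le_sum (f := b) (fun k _ => ?_) (Finset.self_mem_range_succ R))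
    exact (pow_pos hm0 k).le.trans (hb k)
  have hmR : 0 < m ^ R := pow_pos hm0 R
  have hB0 : 0 < B := hmR.trans_le hBm
  have e : (g * ∑ k ∈ Finset.range (R + 1), a k) / B - g * μ =
      g * (∑ k ∈ Finset.range (R + 1), (a k - μ * b k)) / B := by
    rw [Finset.sum_sub_distrib, ← Finset.mul_sum, ← hB]
    field_simp
  have hsum : |∑ k ∈ Finset.range (R + 1), (a k - μ * b k)| ≤
      C * (R + 1) ^ 2 * (max r 1) ^ R := by
    refine (Finset.abs_sum_le_sum_abs _ _).trans ?_
    calc _ ≤ ∑ k ∈ Finset.range (R + 1), C * (R + 1) * (max r 1) ^ R := by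
          refine Finset.sum_le_sum fun k hk => (h k).trans ?_
          have hkR : k ≤ R := Nat.lt_succ_iff.1 (Finset.mem_range.1 hk)
          have h1 : r ^ k ≤ (max r 1) ^ R :=
            (pow_le_pow_left₀ hr.le (le_max_left _ _) k).trans
              (pow_le_pow_right₀ (le_max_right _ _) hkR)
          have h2 : (k : ℝ) ≤ R := by exact_mod_cast hkR
          gcongr
      _ = C * (R + 1) ^ 2 * (max r 1) ^ R := by
          rw [Finset.sum_const, Finset.card_range, nsmul_eq_mul]
          push_cast
          ring
  rw [e, abs_div, abs_mul, abs_of_nonneg hg, abs_of_pos hB0, div_pow]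
  calc g * |∑ k ∈ Finset.range (R + 1), (a k - μ * b k)| / B
      ≤ g * (C * (R + 1) ^ 2 * (max r 1) ^ R) / m ^ R := by gcongr
    _ = _ := by ring

/-- Elements of Γ preserve colours, so the colouring descends to the quotient, which is therefore
bipartite without loops, and parity of distance is read off from colours. -/
theorem even_dist_quotGraph_iff (hT : T.IsTree) (c : T.Coloring Bool) (Γ : Subgroup (TreeAut T))
    (v w : V) :
    Even ((quotGraph Γ).dist (quotVert Γ v) (quotVert Γ w)) ↔ c v = c w := by
  let Q : SimpleGraph (QuotVert Γ) :=
    SimpleGraph.fromRel fun x y => ∃ e, (quotGraph Γ).src e = x ∧ (quotGraph Γ).tgt e = y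
  have hne : ∀ {a b : QuotVert Γ}, (∃ e, (quotGraph Γ).src e = a ∧ (quotGraph Γ).tgt e = b) →
      c a.out ≠ c b.out := by
    rintro _ _ ⟨e, rfl, rfl⟩
    obtain ⟨e, rfl⟩ := Quotient.exists_rep e
    change c (quotVert Γ e.fst).out ≠ c (quotVert Γ e.snd).out
    rw [color_out, color_out]
    exact c.valid e.adj
  let cQ : Q.Coloring Bool := SimpleGraph.Coloring.mk (fun a => c a.out) (by
    intro a b hab
    rw [SimpleGraph.fromRel_adj] at hab
    rcases hab.2 with h | h
    exacts [hne h, (hne h).symm])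
  have hadj : ∀ {u v : V}, T.Adj u v → Q.Adj (quotVert Γ u) (quotVert Γ v) := by
    intro u v h
    have h1 : ∃ e, (quotGraph Γ).src e = quotVert Γ u ∧ (quotGraph Γ).tgt e = quotVert Γ v :=
      ⟨quotEdge Γ ⟨(u, v), h⟩, rfl, rfl⟩
    rw [SimpleGraph.fromRel_adj]
    exact ⟨fun h2 => hne h1 (by rw [h2]), Or.inl h1⟩
  have hreach : Q.Reachable (quotVert Γ v) (quotVert Γ w) := by
    obtain ⟨p⟩ := hT.connected v w
    exact ⟨p.map (⟨quotVert Γ, hadj⟩ : T →g Q)⟩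
  obtain ⟨p, hp⟩ := hreach.exists_walk_length_eq_dist
  change Even (Q.dist (quotVert Γ v) (quotVert Γ w)) ↔ _
  rw [← hp, cQ.even_length_iff_congr p]
  change (c (quotVert Γ v).out = true ↔ c (quotVert Γ w).out = true) ↔ _
  rw [color_out, color_out]
  exact Bool.eq_iff_iff.symm

theorem card_inf_stabilizer (Γ : Subgroup (TreeAut T)) (v : V) :
    Nat.card ↥(Γ ⊓ MulAction.stabilizer (TreeAut T) v) = Nat.card (MulAction.stabilizer Γ v) := by
  refine Nat.card_congr
    { toFun := fun g => ⟨⟨g.1, g.2.1⟩, g.2.2⟩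
      invFun := fun g => ⟨g.1.1, g.1.2, g.2⟩
      left_inv := fun _ => rfl
      right_inv := fun _ => rfl }

theorem hasSum_colorMass (hT : T.IsTree) (c : T.Coloring Bool) (Γ : Subgroup (TreeAut T))
    [∀ v : V, Finite (MulAction.stabilizer Γ v)] (hs : Summable (vertMass Γ)) (o : V)
    (lift : QuotVert Γ → V) (hlift : ∀ v, quotVert Γ (lift v) = v) :
    HasSum (fun v : {v : QuotVert Γ // Even ((quotGraph Γ).dist (quotVert Γ o) v)} =>
      1 / (Nat.card ↥(Γ ⊓ MulAction.stabilizer (TreeAut T) (lift v.1)) : ℝ))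
      (colorMass c Γ (c o)) := by
  classical
  have e1 : ∀ v : QuotVert Γ,
      1 / (Nat.card ↥(Γ ⊓ MulAction.stabilizer (TreeAut T) (lift v)) : ℝ) = vertMass Γ v := by
    intro v
    rw [card_inf_stabilizer, ← vertMass_quotVert Γ (lift v) |>.trans (one_div _).symm, hlift]
  simp_rw [e1]
  have e2 : colorMass c Γ (c o) =
      ∑' v : {v : QuotVert Γ // Even ((quotGraph Γ).dist (quotVert Γ o) v)}, vertMass Γ v := by
    rw [colorMass]
    refine Eq.trans ?_
      (tsum_subtype {v | Even ((quotGraph Γ).dist (quotVert Γ o) v)} (vertMass Γ)).symm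
    refine tsum_congr fun a => ?_
    have := even_dist_quotGraph_iff hT c Γ o a.out
    rw [quotVert_out] at this
    rw [Set.indicator_apply]
    refine if_congr ?_ rfl rfl
    rw [eq_comm, ← this]
    rfl
  rw [e2]
  exact (hs.subtype _).hasSum

end Counting

/-! ### Assembly: covolume, error term and constant. -/

theorem theoremF {V : Type*} {T : SimpleGraph V} (d₁ d₂ : ℕ) (hd₁ : 3 ≤ d₁) (hd₂ : 3 ≤ d₂)
    (hT : IsBiregularTree T d₁ d₂) (Γ : Subgroup (TreeAut T)) (hΓ : IsTreeLattice Γ)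
    (hgf : (quotGraph Γ).IsGeometricallyFinite)
    (m : Measure (TreeAut T)) [m.IsHaarMeasure]
    (mX : Measure (TreeAut T ⧸ Γ)) (hmX : IsInducedMeasure Γ m mX) (o : V) :
    (mX Set.univ ≠ 0 ∧ mX Set.univ ≠ ∞) ∧
    (∃ c : ℝ, 0 < c ∧ c < 1 ∧
      (fun R : ℕ =>
        |(latticeCount Γ o (2 * R) : ℝ) / (evenBallCard T o (2 * R) : ℝ) -
          (m (MulAction.stabilizer (TreeAut T) o : Set (TreeAut T))).toReal /
            (mX Set.univ).toReal|) =o[atTop] fun R : ℕ => c ^ (2 * R)) ∧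
    ∀ lift : QuotVert Γ → V, (∀ v, quotVert Γ (lift v) = v) →
      ∃ S : ℝ,
        HasSum (fun v : {v : QuotVert Γ // Even ((quotGraph Γ).dist (quotVert Γ o) v)} =>
          1 / (Nat.card ↥(Γ ⊓ MulAction.stabilizer (TreeAut T) (lift v.1)) : ℝ)) S ∧
        (m (MulAction.stabilizer (TreeAut T) o : Set (TreeAut T))).toReal /
          (mX Set.univ).toReal = S⁻¹ := by
  classical
  obtain ⟨hT, c, hc⟩ := hT
  let d : Bool → ℕ := fun b => bif b then d₁ else d₂
  have hd : ∀ v, (T.neighborSet v).encard = d (c v) := by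
    intro v
    rw [hc v]
  have hd3 : ∀ i, 3 ≤ d i := by rintro (_ | _) <;> assumption
  have hfin := neighborSet_finite hd
  have : ∀ v : V, Finite (MulAction.stabilizer Γ v) :=
    finite_stabilizer_of_discrete Γ hT.connected hfin hΓ.1
  have hs := summable_vertMass_of_isGeometricallyFinite hT hd hd3 Γ hgf
  have hP := poincare_of_isGeometricallyFinite hT c hd hd3 Γ hs (c o) hgf
  obtain ⟨D, hDm, hD, rfl⟩ := hmX
  have hmD := measure_fundamentalDomain hT c hd m Γ hs o hD hDm
  have hmX : (m.restrict D).map (QuotientGroup.mk : TreeAut T → TreeAut T ⧸ Γ) Set.univ = m D := by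
    rw [Measure.map_apply measurable_quotient_mk'' MeasurableSet.univ, Set.preimage_univ,
      Measure.restrict_apply_univ]
  have hm0 : m (MulAction.stabilizer (TreeAut T) o) ≠ 0 :=
    ((isOpen_stabilizer o).measure_pos m ⟨1, one_mem (MulAction.stabilizer (TreeAut T) o)⟩).ne'
  have hm1 : m (MulAction.stabilizer (TreeAut T) o) ≠ ∞ :=
    (isCompact_stabilizer hT hfin o).measure_lt_top.ne
  have hS : 0 < colorMass c Γ (c o) := by
    rw [← quotKernel_int_even hT c hd hd3 Γ hs]
    refine BipartiteKernel.int_even_pos (o := quotVert Γ o) ?_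
    change (c (quotVert Γ o).out == c o) = true
    rw [color_out, beq_self_eq_true]
  have hratio : (m (MulAction.stabilizer (TreeAut T) o : Set (TreeAut T))).toReal /
      (m D).toReal = (colorMass c Γ (c o))⁻¹ := by
    have h0 : (m (MulAction.stabilizer (TreeAut T) o : Set (TreeAut T))).toReal ≠ 0 :=
      ENNReal.toReal_ne_zero.2 ⟨hm0, hm1⟩
    rw [hmD, ENNReal.toReal_mul, ENNReal.toReal_ofReal hS.le]
    field_simp
  rw [hmX]
  refine ⟨⟨?_, ?_⟩, ?_, fun lift hlift => ⟨_, hasSum_colorMass hT c Γ hs o lift hlift, hratio⟩⟩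
  · rw [hmD]
    exact mul_ne_zero hm0 (ENNReal.ofReal_pos.2 hS).ne'
  · rw [hmD]
    exact ENNReal.mul_ne_top hm1 ENNReal.ofReal_ne_top
  obtain ⟨r, C, hr, hrm, hC, h⟩ := exists_abs_card_orbit_sub_le hT c hd hd3 Γ hs (c o) hP rfl
  have hdi : (3 : ℝ) ≤ d (c o) := by exact_mod_cast hd3 (c o)
  have hdj : (3 : ℝ) ≤ d (!(c o)) := by exact_mod_cast hd3 (!(c o))
  set M : ℝ := (d (c o) - 1) * (d (!(c o)) - 1) with hM
  have hM1 : 1 < M := by nlinarith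
  have hsph : ∀ k, M ^ k ≤ ((T.sphere o (2 * k)).card : ℝ) := by
    intro k
    have h1 := pow_le_card_sphere hT hd o k
    have h2 : (((d (c o) - 1) * (d (!(c o)) - 1) : ℕ) : ℝ) = M := by
      rw [hM, Nat.cast_mul, Nat.cast_sub (by have := hd3 (c o); omega),
        Nat.cast_sub (by have := hd3 (!(c o)); omega), Nat.cast_one]
    rw [← h2]
    exact_mod_cast h1
  refine exists_isLittleO_pow (C := Nat.card (MulAction.stabilizer Γ o) * C) (θ := max r 1 / M)
    (by positivity) ?_ fun R => ?_
  · rw [div_lt_one (by linarith)]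
    exact max_lt hrm hM1
  · have key := abs_div_sub_le (Nat.cast_nonneg (Nat.card (MulAction.stabilizer Γ o))) hC hr hM1
      hsph h R
    -- The multiplicity |Γ_o| of each orbit point cancels the mass 1/|Γ_o| in the main term, so the
    -- limit is the reciprocal of the mass of the colour class.
    have hg : (Nat.card (MulAction.stabilizer Γ o) : ℝ) *
        (vertMass Γ (quotVert Γ o) / colorMass c Γ (c o)) = (colorMass c Γ (c o))⁻¹ := by
      have : (Nat.card (MulAction.stabilizer Γ o) : ℝ) ≠ 0 :=
        Nat.cast_ne_zero.2 Nat.card_pos.ne'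
      rw [vertMass_quotVert]
      field_simp
    rw [abs_abs, hratio, ← hg, latticeCount_eq_sum hT hfin, evenBallCard_eq_sum hT.connected hfin]
    push_cast
    exact key
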